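/- Let $\mathbb{F}_q$ be a finite field with $q$ elements, let $n\ge 0$ be an integer, and fix a nontrivial homomorphism $\theta:\mathbb{F}_q^+\to\mathbb{C}^\times$. For $m \ge 0$ let $U_m=U_m(\mathbb{F}_q)$ be the group of upper triangular $m\times m$ matrices over $\mathbb{F}_q$ with ones on the diagonal, and let $\mathfrak{u}_m=\mathfrak{u}_m(\mathbb{F}_q)$ be the space of strictly upper triangular $m\times m$ matrices. For $\lambda\in\mathfrak{u}_m^*$ put $v_\lambda=\sum_{g\in U_m}\theta(\lambda(g-1))\,g\in\mathbb{C}U_m$. The supercharacters of $U_m$ are the characters of the left modules $\mathbb{C}U_m v_\lambda$, $\lambda\in\mathfrak{u}_m^*$; write $\chi_\lambda$ for the complex conjugate of the character of $\mathbb{C}U_m v_\lambda$. A pair $(i,j)$ is an arc of a set partition $\Lambda$ of $[m]=\{1,\dots,m\}$ if $i$ and $j$ lie in the same block and $j$ is the least element of this block greater than $i$. An $\mathbb{F}_q$-labeled set partition $\Lambda$ of $[m]$ is a set partition of $[m]$ together with a label $\Lambda_{ij}\in\mathbb{F}_q^\times$ for each arc $(i,j)$; let $\chi_\Lambda=\chi_\lambda$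 for $\lambda(X)=\sum_{(i,j)}\Lambda_{ij}X_{ij}$, the sum being over the arcs of $\Lambda$. A set partition, labeled or not, is feasible if each of its blocks has at least two elements. For an $\mathbb{F}_q$-labeled set partition $\Lambda$ of $[n]$, let $\mathrm{shift}(\Lambda)$ be the $\mathbb{F}_q$-labeled set partition of $[n+1]$ whose arcs are the pairs $(i,j+1)$ for the arcs $(i,j)$ of $\Lambda$, where $(i,j+1)$ has label $\Lambda_{ij}$. Let $C$ be the group of linear characters $g\mapsto\vartheta(g_{1,2}+g_{2,3}+\dots+g_{n,n+1})$ of $U_{n+1}$, where $\vartheta$ runs over all homomorphisms $\mathbb{F}_q^+\to\mathbb{C}^\times$. A supercharacter $\chi$ of $U_{n+1}$ is $C$-invariant if $\psi\chi=\chi$ for all $\psi\in C$. Then $\Lambda\mapsto\chi_{\mathrm{shift}(\Lambda)}$ is a bijection from the set of feasible $\mathbb{F}_q$-labeled set partitions of $[n]$ onto the set of $C$-invariant supercharacters of $U_{n+1}(\mathbb{F}_q)$. Hence $U_{n+1}(\mathbb{F}_q)$ has exactly $\mathrm{Fe}_n(q-1)$ distinct $C$-invariant supercharacters, where $\mathrm{Fe}_n(x)=\sum_{k=0}^n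 S(n,k)\,x^{n-k}$ and $S(n,k)$ is the number of feasible set partitions of $[n]$ with exactly $k$ blocks. -/

import Mathlib

/-! ### The unitriangular group and its supercharacters -/

/-- The algebra of strictly upper triangular `n × n` matrices over `F`, as a subspace of all
matrices. -/
def strictUpper (n : ℕ) (F : Type*) [Field F] : Submodule F (Matrix (Fin n) (Fin n) F) where
  carrier := {X | ∀ i j, j ≤ i → X i j = 0}
  add_mem' := by
    intro X Y hX hY i j h
    simp [hX i j h, hY i j h]
  zero_mem' := by
    intro i j _
    rfl
  smul_mem' := by
    intro c X hX i j h
    simp [hX i j h]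

theorem strictUpper_mul {n : ℕ} {F : Type*} [Field F] {M X : Matrix (Fin n) (Fin n) F}
    (hM : M.BlockTriangular id) (hX : X ∈ strictUpper n F) : M * X ∈ strictUpper n F := by
  intro i j hij
  rw [Matrix.mul_apply]
  refine Finset.sum_eq_zero fun k _ => ?_
  rcases lt_or_ge k i with h | h
  · rw [hM h, zero_mul]
  · rw [hX k j (hij.trans h), mul_zero]

theorem blockTriangular_of_sub_one_mem {n : ℕ} {F : Type*} [Field F]
    {M : Matrix (Fin n) (Fin n) F} (h : M - 1 ∈ strictUpper n F) : M.BlockTriangular id := by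
  intro i j hij
  have hij' : j < i := hij
  have := h i j hij'.le
  simpa [Matrix.one_apply_ne hij'.ne'] using this

/-- The unitriangular group: the invertible matrices `g` for which `g - 1` is strictly upper
triangular, that is, the upper triangular matrices with ones on the diagonal. -/
def unitri (n : ℕ) (F : Type*) [Field F] : Subgroup (Matrix.GeneralLinearGroup (Fin n) F) where
  carrier := {g | (g : Matrix (Fin n) (Fin n) F) - 1 ∈ strictUpper n F}
  mul_mem' := by
    intro g h hg hh
    have hg' : (g : Matrix (Fin n) (Fin n) F) - 1 ∈ strictUpper n F := hg
    have key : ((g * h : Matrix.GeneralLinearGroup (Fin n) F) : Matrix (Fin n) (Fin n) F) - 1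
        = (g : Matrix (Fin n) (Fin n) F) * ((h : Matrix (Fin n) (Fin n) F) - 1)
          + ((g : Matrix (Fin n) (Fin n) F) - 1) := by
      rw [Units.val_mul, mul_sub, mul_one]
      abel
    show _ - 1 ∈ strictUpper n F
    rw [key]
    exact add_mem (strictUpper_mul (blockTriangular_of_sub_one_mem hg') hh) hg'
  one_mem' := by
    show _ - 1 ∈ strictUpper n F
    rw [Units.val_one, sub_self]
    exact zero_mem _
  inv_mem' := by
    intro g hg
    have hg' : (g : Matrix (Fin n) (Fin n) F) - 1 ∈ strictUpper n F := hg
    have key : ((g⁻¹ : Matrix.GeneralLinearGroup (Fin n) F) : Matrix (Fin n) (Fin n) F) - 1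
        = -(((g⁻¹ : Matrix.GeneralLinearGroup (Fin n) F) : Matrix (Fin n) (Fin n) F)
          * ((g : Matrix (Fin n) (Fin n) F) - 1)) := by
      rw [mul_sub, mul_one, Units.inv_mul]
      abel
    have hinv : ((g⁻¹ : Matrix.GeneralLinearGroup (Fin n) F) :
        Matrix (Fin n) (Fin n) F).BlockTriangular id := by
      rw [Matrix.coe_units_inv]
      have : Invertible (g : Matrix (Fin n) (Fin n) F) := g.invertible
      exact Matrix.blockTriangular_inv_of_blockTriangular (blockTriangular_of_sub_one_mem hg')
    show _ - 1 ∈ strictUpper n F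
    rw [key]
    exact neg_mem (strictUpper_mul hinv hg')

/-- For `g` in the unitriangular group, the element `g - 1` of the algebra of strictly upper
triangular matrices. -/
def unitriSubOne {n : ℕ} {F : Type*} [Field F] (g : unitri n F) : strictUpper n F :=
  ⟨((g : Matrix.GeneralLinearGroup (Fin n) F) : Matrix (Fin n) (Fin n) F) - 1, g.2⟩

/-- The element `v_lam = ∑_g θ(lam(g - 1)) g` of the complex group algebra of the unitriangular
group. -/
noncomputable def vElt {n : ℕ} {F : Type*} [Field F] [Fintype F] (θ : AddChar F ℂ)
    (lam : Module.Dual F (strictUpper n F)) : MonoidAlgebra ℂ (unitri n F) :=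
  letI : Fintype (unitri n F) := Fintype.ofFinite _
  ∑ g : unitri n F, MonoidAlgebra.single g (θ (lam (unitriSubOne g)))

/-- The character of the left module `ℂG v_lam` (the left ideal generated by `v_lam`), where `G`
is the unitriangular group: at `g` it is the trace of left multiplication by `g`. -/
noncomputable def moduleChar {n : ℕ} {F : Type*} [Field F] [Fintype F] (θ : AddChar F ℂ)
    (lam : Module.Dual F (strictUpper n F)) : unitri n F → ℂ :=
  (Representation.ofModule' (k := ℂ) (G := unitri n F)
    (Ideal.span ({vElt θ lam} : Set (MonoidAlgebra ℂ (unitri n F))))).character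

/-- The set of supercharacters of the unitriangular group. -/
def supercharacters (n : ℕ) {F : Type*} [Field F] [Fintype F] (θ : AddChar F ℂ) :
    Set (unitri n F → ℂ) :=
  Set.range (moduleChar θ)

/-- The supercharacter `χ_lam`: the complex conjugate of the character of `ℂG v_lam`. -/
noncomputable def superchar {n : ℕ} {F : Type*} [Field F] [Fintype F] (θ : AddChar F ℂ)
    (lam : Module.Dual F (strictUpper n F)) : unitri n F → ℂ :=
  fun g => starRingEnd ℂ (moduleChar θ lam g)

/-! ### Invariance under the group `C` of linear characters -/

/-- The sum of the entries on the first superdiagonal. -/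
def superdiagSum {n : ℕ} {F : Type*} [Field F] (g : unitri (n + 1) F) : F :=
  ∑ i : Fin n, ((g : Matrix.GeneralLinearGroup (Fin (n + 1)) F) :
    Matrix (Fin (n + 1)) (Fin (n + 1)) F) i.castSucc i.succ

/-- The group `C` of linear characters `ϑ ∘ σ`, where `σ` is the sum of the first superdiagonal and
`ϑ` runs over all homomorphisms from the additive group of `F` to the nonzero complex numbers. -/
def linCharC (n : ℕ) (F : Type*) [Field F] : Set (unitri (n + 1) F → ℂ) :=
  Set.range fun (ϑ : AddChar F ℂ) (g : unitri (n + 1) F) => ϑ (superdiagSum g)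

/-- A function on the group is `C`-invariant if multiplication by each element of `C` fixes it. -/
def IsCInvariant {n : ℕ} {F : Type*} [Field F] (χ : unitri (n + 1) F → ℂ) : Prop :=
  ∀ ψ ∈ linCharC n F, ψ * χ = χ

/-! ### Labeled set partitions -/

/-- Set partitions of an `n`-element ordered set. -/
abbrev SetPartition (n : ℕ) := Finpartition (Finset.univ : Finset (Fin n))

/-- `(i, j)` is an arc of `P` if `i` and `j` lie in a common block and `j` is the least element
of that block greater than `i`. -/
def SetPartition.IsArc {n : ℕ} (P : SetPartition n) (i j : Fin n) : Prop :=
  ∃ B ∈ P.parts, i ∈ B ∧ j ∈ B ∧ i < j ∧ ∀ k ∈ B, i < k → j ≤ k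

/-- A set partition is feasible if each of its blocks has at least two elements. -/
def SetPartition.IsFeasible {n : ℕ} (P : SetPartition n) : Prop :=
  ∀ B ∈ P.parts, 2 ≤ B.card

/-- An `F`-labeled set partition: a set partition with a nonzero element of `F` for each arc. -/
structure LabeledPartition (n : ℕ) (F : Type*) [Field F] where
  part : SetPartition n
  label : {a : Fin n × Fin n // part.IsArc a.1 a.2} → Fˣ

/-- The functional `X ↦ ∑ Λ_ij X_ij`, the sum being over the arcs `(i, j)` of `Λ`. -/
noncomputable def LabeledPartition.functional {n : ℕ} {F : Type*} [Field F]
    (Λ : LabeledPartition n F) : Module.Dual F (strictUpper n F) :=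
  letI : Fintype {a : Fin n × Fin n // Λ.part.IsArc a.1 a.2} := Fintype.ofFinite _
  { toFun := fun X => ∑ a : {a : Fin n × Fin n // Λ.part.IsArc a.1 a.2},
      (Λ.label a : F) * (X : Matrix (Fin n) (Fin n) F) a.1.1 a.1.2
    map_add' := by
      intro X Y
      simp [mul_add, Finset.sum_add_distrib]
    map_smul' := by
      intro c X
      simp only [Submodule.coe_smul, Matrix.smul_apply, smul_eq_mul, RingHom.id_apply,
        Finset.mul_sum]
      exact Finset.sum_congr rfl fun a _ => by ring }

/-- The set partition whose blocks are the connected components of the graph on `Fin n` with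
edges given by the relation `A`. -/
noncomputable def SetPartition.ofArcs {n : ℕ} (A : Fin n → Fin n → Prop) : SetPartition n :=
  letI : DecidableRel (Relation.EqvGen.setoid A).r := Classical.decRel _
  Finpartition.ofSetoid (Relation.EqvGen.setoid A)

theorem SetPartition.mem_ofArcs {n : ℕ} (A : Fin n → Fin n → Prop) (i j : Fin n) :
    (∃ B ∈ (SetPartition.ofArcs A).parts, i ∈ B ∧ j ∈ B) ↔ Relation.EqvGen A i j := by
  let _ : DecidableRel (Relation.EqvGen.setoid A).r := Classical.decRel _
  have h := Finpartition.mem_part_ofSetoid_iff_rel (s := Relation.EqvGen.setoid A) (a := i) (b := j)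
  change j ∈ (SetPartition.ofArcs A).part i ↔ Relation.EqvGen A i j at h
  rw [← h, Finpartition.mem_part_iff_exists]
  constructor
  · rintro ⟨B, hB, hi, hj⟩
    exact ⟨B, hB, hj, hi⟩
  · rintro ⟨B, hB, hi, hj⟩
    exact ⟨B, hB, hj, hi⟩

/-- If the relation `A` is increasing and each point has at most one successor and at most one
predecessor for `A`, then the arcs of `ofArcs A` are exactly the pairs related by `A`. -/
theorem SetPartition.isArc_ofArcs {n : ℕ} {A : Fin n → Fin n → Prop}
    (hlt : ∀ i j, A i j → i < j) (hr : ∀ i j k, A i j → A i k → j = k)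
    (hl : ∀ i j k, A i k → A j k → i = j) (i j : Fin n) :
    (SetPartition.ofArcs A).IsArc i j ↔ A i j := by
  have hle : ∀ a b, Relation.ReflTransGen A a b → a ≤ b := by
    intro a b h
    induction h with
    | refl => exact le_rfl
    | tail _ h ih => exact ih.trans (hlt _ _ h).le
  have htot : ∀ a b, Relation.EqvGen A a b →
      Relation.ReflTransGen A a b ∨ Relation.ReflTransGen A b a := by
    intro a b h
    induction h with
    | rel x y h => exact Or.inl (.single h)
    | refl x => exact Or.inl .refl
    | symm x y _ ih => exact ih.symm
    | trans x y z _ _ ih1 ih2 =>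
      rcases ih1 with h1 | h1 <;> rcases ih2 with h2 | h2
      · exact Or.inl (h1.trans h2)
      · have := Relation.ReflTransGen.total_of_right_unique (r := Function.swap A)
          (fun a b c hb hc => hl b c a hb hc) (Relation.reflTransGen_swap.2 h1)
          (Relation.reflTransGen_swap.2 h2)
        rcases this with h | h
        · exact Or.inr (Relation.reflTransGen_swap.1 h)
        · exact Or.inl (Relation.reflTransGen_swap.1 h)
      · exact Relation.ReflTransGen.total_of_right_unique (fun a b c hb hc => hr a b c hb hc) h1 h2
      · exact Or.inr (h2.trans h1)
  constructor
  · rintro ⟨B, hB, hi, hj, hij, hmin⟩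
    have hE := (SetPartition.mem_ofArcs A i j).1 ⟨B, hB, hi, hj⟩
    rcases htot i j hE with h | h
    · rcases Relation.ReflTransGen.cases_head h with h | ⟨m, him, hmj⟩
      · exact absurd h hij.ne
      · obtain ⟨B', hB', hi', hm'⟩ := (SetPartition.mem_ofArcs A i m).2 (.rel _ _ him)
        have hBB : B = B' := (SetPartition.ofArcs A).eq_of_mem_parts hB hB' hi hi'
        have : j ≤ m := hmin m (hBB ▸ hm') (hlt _ _ him)
        rwa [le_antisymm this (hle _ _ hmj)]
    · exact absurd (hle _ _ h) (not_le.2 hij)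
  · intro hA
    obtain ⟨B, hB, hi, hj⟩ := (SetPartition.mem_ofArcs A i j).2 (.rel _ _ hA)
    refine ⟨B, hB, hi, hj, hlt _ _ hA, fun k hk hik => ?_⟩
    rcases htot i k ((SetPartition.mem_ofArcs A i k).1 ⟨B, hB, hi, hk⟩) with h | h
    · rcases Relation.ReflTransGen.cases_head h with h | ⟨m, him, hmk⟩
      · exact absurd h hik.ne
      · rw [hr i j m hA him]
        exact hle _ _ hmk
    · exact absurd (hle _ _ h) (not_le.2 hik)

theorem SetPartition.IsArc.right_unique {n : ℕ} {P : SetPartition n} {i j k : Fin n}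
    (hj : P.IsArc i j) (hk : P.IsArc i k) : j = k := by
  obtain ⟨B, hB, hiB, hjB, hij, hjmin⟩ := hj
  obtain ⟨B', hB', hiB', hkB', hik, hkmin⟩ := hk
  obtain rfl : B = B' := P.eq_of_mem_parts hB hB' hiB hiB'
  exact le_antisymm (hjmin k hkB' hik) (hkmin j hjB hij)

theorem SetPartition.IsArc.left_unique {n : ℕ} {P : SetPartition n} {i j k : Fin n}
    (hi : P.IsArc i k) (hj : P.IsArc j k) : i = j := by
  obtain ⟨B, hB, hiB, hkB, hik, himin⟩ := hi
  obtain ⟨B', hB', hjB', hkB', hjk, hjmin⟩ := hj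
  obtain rfl : B = B' := P.eq_of_mem_parts hB hB' hkB hkB'
  rcases lt_trichotomy i j with h | h | h
  · exact absurd (himin j hjB' h) (not_le.2 hjk)
  · exact h
  · exact absurd (hjmin i hiB h) (not_le.2 hik)

/-- The relation on `Fin (n + 1)` which relates `i` to `j + 1` for each arc `(i, j)` of `P`. -/
def SetPartition.shiftRel {n : ℕ} (P : SetPartition n) (a b : Fin (n + 1)) : Prop :=
  ∃ (ha : a ≠ Fin.last n) (hb : b ≠ 0), P.IsArc (a.castPred ha) (b.pred hb)

/-- The set partition of an `(n + 1)`-element set with arcs `(i, j + 1)` for the arcs `(i, j)`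
of `P`. -/
noncomputable def SetPartition.shift {n : ℕ} (P : SetPartition n) : SetPartition (n + 1) :=
  SetPartition.ofArcs P.shiftRel

theorem SetPartition.isArc_shift {n : ℕ} (P : SetPartition n) (a b : Fin (n + 1)) :
    P.shift.IsArc a b ↔ P.shiftRel a b := by
  refine SetPartition.isArc_ofArcs ?_ ?_ ?_ a b
  · rintro i j ⟨hi, hj, B, -, -, -, h, -⟩
    have h' : (i : ℕ) < (j : ℕ) - 1 := by simpa [Fin.lt_def] using h
    rw [Fin.lt_def]
    omega
  · rintro i j k ⟨hi, hj, h⟩ ⟨hi', hk, h'⟩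
    exact Fin.pred_inj.1 (h.right_unique h')
  · rintro i j k ⟨hi, hk, h⟩ ⟨hj, hk', h'⟩
    exact Fin.castPred_inj.1 (h.left_unique h')

/-- The shift of a labeled set partition: its arcs are the pairs `(i, j + 1)` for the arcs `(i, j)`
of `Λ`, and `(i, j + 1)` has the label that `(i, j)` has in `Λ`. -/
noncomputable def LabeledPartition.shift {n : ℕ} {F : Type*} [Field F]
    (Λ : LabeledPartition n F) : LabeledPartition (n + 1) F where
  part := Λ.part.shift
  label := fun a =>
    have h : Λ.part.shiftRel a.1.1 a.1.2 := (Λ.part.isArc_shift a.1.1 a.1.2).1 a.2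
    Λ.label ⟨(a.1.1.castPred h.fst, a.1.2.pred h.snd.fst), h.snd.snd⟩

/-- The arcs of `shift Λ` are the pairs `(i, j + 1)` with `(i, j)` an arc of `Λ`. -/
theorem LabeledPartition.isArc_shift_iff {n : ℕ} {F : Type*} [Field F] (Λ : LabeledPartition n F)
    (a b : Fin (n + 1)) : Λ.shift.part.IsArc a b ↔
      ∃ i j : Fin n, Λ.part.IsArc i j ∧ a = i.castSucc ∧ b = j.succ := by
  refine (Λ.part.isArc_shift a b).trans ⟨?_, ?_⟩
  · rintro ⟨ha, hb, h⟩
    exact ⟨_, _, h, by simp, by simp⟩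
  · rintro ⟨i, j, h, rfl, rfl⟩
    exact ⟨Fin.castSucc_ne_last i, Fin.succ_ne_zero j, by simpa using h⟩

/-! ### The counting polynomial -/

/-- The number of feasible partitions of `[n]` with `k` blocks (an associated Stirling number of
the second kind). -/
noncomputable def assocStirling (n k : ℕ) : ℕ :=
  Nat.card {P : SetPartition n // P.IsFeasible ∧ P.parts.card = k}

/-- The polynomial `Fe_n(x) = ∑_{k = 0}^n S(n, k) x ^ (n - k)`, where `S(n, k)` is the number of
feasible partitions of `[n]` with `k` blocks. -/
noncomputable def feasiblePoly (n : ℕ) : Polynomial ℤ :=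
  ∑ k ∈ Finset.range (n + 1), Polynomial.C (assocStirling n k : ℤ) * Polynomial.X ^ (n - k)

/-! ### Two-sided translation of functionals -/

/-! Write `G` for the unitriangular group. The `v_mu`, for `mu` in the left orbit of `lam`, form a
basis of `ℂG v_lam` which `G` permutes up to scalars. Taking the trace and averaging over right
translations gives, up to a nonzero factor depending only on the orbit, `χ_lam(g) = ∑ θ(lam(k(g -
1)h))`, summed over `k, h ∈ G` (`superchar_eq_orbitSum`). Fourier inversion on strictly upper
triangular matrices then shows that supercharacters correspond to two-sided orbits of functionals
(`superchar_eq_iff`).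

Viewing functionals as matrices, each two-sided orbit contains exactly one rook matrix, that is, one
labeled set partition: existence is Gaussian elimination (`exists_sameOrbit_isRook`), uniqueness is
`IsRook.eq_of_sameOrbit`.

Superdiagonal functionals are fixed by both translations, so adding `c` to every superdiagonal entry
of `lam` multiplies `χ_lam` by the linear character `θ(c σ)`, with `σ` the superdiagonal sum. Thus
`C`-invariance asks whether the orbit of a rook matrix `M` absorbs these additions. A nonzero entry
to the right of `(k, k + 1)` or above it lets a single column or row operation change that entry
alone; where there is none, adding there gives another rook matrix, hence another orbit. So `χ` is
`C`-invariant exactly when every position `(k, k + 1)` is covered (`isCInvariant_superchar_iff`).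

Covered positions carry no entry of `M`, so `M` is the shift of a labeled partition `Λ` of `[n]`. An
entry right of or above `(k, k + 1)` is an arc of `Λ` starting or ending at `k`, so covering says
that `Λ` has no singleton block. For the count, a partition with `k` blocks has `n - k` arcs to
label. -/

noncomputable instance unitri.instFintype {n : ℕ} {F : Type*} [Field F] [Fintype F] :
    Fintype (unitri n F) :=
  Fintype.ofFinite _

noncomputable instance strictUpper.instFintype {n : ℕ} {F : Type*} [Field F] [Fintype F] :
    Fintype (strictUpper n F) :=
  Fintype.ofFinite _

section Translation

variable {n : ℕ} {F : Type*} [Field F]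

theorem unitri.blockTriangular (g : unitri n F) :
    (g.1.1 : Matrix (Fin n) (Fin n) F).BlockTriangular id :=
  blockTriangular_of_sub_one_mem g.2

theorem mul_strictUpper {M X : Matrix (Fin n) (Fin n) F}
    (hM : M.BlockTriangular id) (hX : X ∈ strictUpper n F) : X * M ∈ strictUpper n F := by
  intro i j hij
  rw [Matrix.mul_apply]
  refine Finset.sum_eq_zero fun k _ => ?_
  rcases lt_or_ge j k with h | h
  · rw [hM h, mul_zero]
  · rw [hX i k (h.trans hij), zero_mul]

/-- The linear map `X ↦ g X h` on strictly upper triangular matrices. -/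
def biMul (g h : unitri n F) : strictUpper n F →ₗ[F] strictUpper n F where
  toFun X := ⟨g.1.1 * X.1 * h.1.1, mul_strictUpper (unitri.blockTriangular h)
    (strictUpper_mul (unitri.blockTriangular g) X.2)⟩
  map_add' X Y := by
    ext1
    simp [mul_add, add_mul]
  map_smul' c X := by
    ext1
    simp

theorem coe_biMul (g h : unitri n F) (X : strictUpper n F) :
    (biMul g h X : Matrix (Fin n) (Fin n) F) = g.1.1 * X.1 * h.1.1 := rfl

theorem biMul_biMul (g h g' h' : unitri n F) (X : strictUpper n F) :
    biMul g h (biMul g' h' X) = biMul (g * g') (h' * h) X := by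
  ext1
  simp [coe_biMul, mul_assoc]

@[simp] theorem biMul_one_one (X : strictUpper n F) : biMul 1 1 X = X := by
  ext1
  simp [coe_biMul]

theorem coe_unitriSubOne (g : unitri n F) :
    (unitriSubOne g : Matrix (Fin n) (Fin n) F) = g.1.1 - 1 := rfl

@[simp] theorem unitriSubOne_one : unitriSubOne (1 : unitri n F) = 0 := by
  ext1
  simp [coe_unitriSubOne]

theorem unitriSubOne_mul (g h : unitri n F) :
    unitriSubOne (g * h) = biMul g 1 (unitriSubOne h) + unitriSubOne g := by
  ext1
  simp [coe_biMul, coe_unitriSubOne, mul_sub]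

/-- The unitriangular matrix `1 + X`. -/
noncomputable def oneAdd (X : strictUpper n F) : unitri n F :=
  ⟨Matrix.GeneralLinearGroup.mk'' (1 + X.1) (by
    have h : (1 + X.1).BlockTriangular id :=
      blockTriangular_of_sub_one_mem (by simp)
    rw [Matrix.det_of_isUpperTriangular h]
    simp [X.2 _ _ le_rfl]), by
    change (1 + X.1) - 1 ∈ strictUpper n F
    simp⟩

theorem coe_oneAdd (X : strictUpper n F) : (oneAdd X).1.1 = 1 + X.1 := rfl

/-- The bijection `g ↦ g - 1` from the unitriangular group to the strictly upper triangular
matrices. -/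
noncomputable def subOneEquiv (n : ℕ) (F : Type*) [Field F] : unitri n F ≃ strictUpper n F where
  toFun := unitriSubOne
  invFun := oneAdd
  left_inv g := by
    ext1
    ext1
    simp [coe_oneAdd, coe_unitriSubOne]
  right_inv X := by
    ext1
    simp [coe_oneAdd, coe_unitriSubOne]

/-- The functional `X ↦ lam (g X h)`. -/
def biTranslate (lam : Module.Dual F (strictUpper n F)) (g h : unitri n F) :
    Module.Dual F (strictUpper n F) :=
  lam ∘ₗ biMul g h

theorem biTranslate_apply (lam : Module.Dual F (strictUpper n F)) (g h : unitri n F)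
    (X : strictUpper n F) : biTranslate lam g h X = lam (biMul g h X) := rfl

@[simp] theorem biTranslate_one_one (lam : Module.Dual F (strictUpper n F)) :
    biTranslate lam 1 1 = lam := by
  ext X
  simp [biTranslate_apply]

theorem biTranslate_biTranslate (lam : Module.Dual F (strictUpper n F)) (g h g' h' : unitri n F) :
    biTranslate (biTranslate lam g h) g' h' = biTranslate lam (g * g') (h' * h) := by
  ext X
  simp [biTranslate_apply, biMul_biMul]

/-- Two functionals are in the same two-sided orbit of the unitriangular group. -/
def SameOrbit (lam mu : Module.Dual F (strictUpper n F)) : Prop :=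
  ∃ g h : unitri n F, mu = biTranslate lam g h

theorem SameOrbit.refl (lam : Module.Dual F (strictUpper n F)) : SameOrbit lam lam :=
  ⟨1, 1, by simp⟩

theorem SameOrbit.symm {lam mu : Module.Dual F (strictUpper n F)} (h : SameOrbit lam mu) :
    SameOrbit mu lam := by
  obtain ⟨g, k, rfl⟩ := h
  exact ⟨g⁻¹, k⁻¹, by simp [biTranslate_biTranslate]⟩

theorem SameOrbit.trans {lam mu nu : Module.Dual F (strictUpper n F)} (h : SameOrbit lam mu)
    (h' : SameOrbit mu nu) : SameOrbit lam nu := by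
  obtain ⟨g, k, rfl⟩ := h
  obtain ⟨g', k', rfl⟩ := h'
  exact ⟨g * g', k' * k, by simp [biTranslate_biTranslate]⟩

end Translation

/-! ### The module generated by `v_lam` -/

section ModuleChar

variable {n : ℕ} {F : Type*} [Field F] [Fintype F] {θ : AddChar F ℂ}

omit [Fintype F] in
theorem addChar_ne_zero (θ : AddChar F ℂ) (a : F) : θ a ≠ 0 := by
  intro h
  have h2 := θ.map_add_eq_mul a (-a)
  rw [h, zero_mul, add_neg_cancel, AddChar.map_zero_eq_one] at h2
  exact one_ne_zero h2

omit [Fintype F] in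
theorem addChar_mul_ne_one (hθ : θ ≠ 1) {a : F} (ha : a ≠ 0) : ∃ c, θ (c * a) ≠ 1 := by
  obtain ⟨x, hx⟩ := AddChar.ne_one_iff.1 hθ
  exact ⟨x / a, by rwa [div_mul_cancel₀ _ ha]⟩

/-- The additive character `θ ∘ lam`. -/
def dualChar (θ : AddChar F ℂ) (lam : Module.Dual F (strictUpper n F)) :
    AddChar (strictUpper n F) ℂ :=
  θ.compAddMonoidHom lam.toAddMonoidHom

omit [Fintype F] in
theorem dualChar_apply (lam : Module.Dual F (strictUpper n F)) (X : strictUpper n F) :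
    dualChar θ lam X = θ (lam X) := rfl

/-- If two functionals differ at `X`, the difference takes every value of `F` on multiples of `X`,
including one where `θ` is not `1`. -/
theorem dualChar_injective (hθ : θ ≠ 1) : Function.Injective (dualChar (n := n) θ) := by
  intro lam mu h
  ext X
  by_contra hne
  obtain ⟨c, hc⟩ := addChar_mul_ne_one hθ (sub_ne_zero.2 hne)
  apply hc
  have h1 : θ (lam (c • X)) = θ (mu (c • X)) := DFunLike.congr_fun h (c • X)
  rw [LinearMap.map_smul, LinearMap.map_smul, smul_eq_mul, smul_eq_mul] at h1
  rw [mul_sub, AddChar.map_sub_eq_div, h1, div_self (addChar_ne_zero _ _)]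

theorem coeff_vElt (lam : Module.Dual F (strictUpper n F)) (g : unitri n F) :
    (vElt θ lam).coeff g = θ (lam (unitriSubOne g)) := by
  classical
  simp [vElt, MonoidAlgebra.coeff_sum, Finsupp.finsetSum_apply, Finsupp.single_apply]

/-- In the coordinate `X = g - 1`, the coefficients of `v_lam` form the additive character `θ ∘
lam`, and distinct characters are linearly independent. -/
theorem linearIndependent_vElt (hθ : θ ≠ 1) :
    LinearIndependent ℂ (vElt (n := n) θ) := by
  have h := (AddChar.linearIndependent (strictUpper n F) ℂ).comp _
    (dualChar_injective (n := n) hθ)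
  let f : MonoidAlgebra ℂ (unitri n F) →ₗ[ℂ] (strictUpper n F → ℂ) :=
    { toFun := fun a X => a.coeff (oneAdd X)
      map_add' := fun a b => by ext; simp
      map_smul' := fun c a => by ext; simp }
  refine LinearIndependent.of_comp f ?_
  have hf : f ∘ vElt θ = DFunLike.coe ∘ dualChar θ := by
    ext lam X
    have hX : unitriSubOne (oneAdd X) = X := (subOneEquiv n F).apply_symm_apply X
    change (vElt θ lam).coeff (oneAdd X) = dualChar θ lam X
    rw [coeff_vElt, dualChar_apply, hX]
  rw [hf]
  exact h

/-- The identity `g⁻¹h - 1 = g⁻¹(h - 1) + (g⁻¹ - 1)` splits each coefficient into a translated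
functional and a scalar independent of `h`; the action on the `v_mu` is therefore monomial. -/
theorem single_mul_vElt (lam : Module.Dual F (strictUpper n F)) (g : unitri n F) :
    MonoidAlgebra.single g (1 : ℂ) * vElt θ lam =
      θ (lam (unitriSubOne g⁻¹)) • vElt θ (biTranslate lam g⁻¹ 1) := by
  ext h
  rw [MonoidAlgebra.coeff_single_mul_apply, MonoidAlgebra.coeff_smul, Finsupp.smul_apply,
    coeff_vElt, coeff_vElt, unitriSubOne_mul, map_add, AddChar.map_add_eq_mul, biTranslate_apply,
    one_mul, smul_eq_mul, mul_comm]

/-- The left orbit of a functional. -/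
abbrev leftOrbit (lam : Module.Dual F (strictUpper n F)) : Set (Module.Dual F (strictUpper n F)) :=
  Set.range fun k : unitri n F => biTranslate lam k 1

omit [Fintype F] in
theorem biTranslate_mem_leftOrbit {lam mu : Module.Dual F (strictUpper n F)}
    (h : mu ∈ leftOrbit lam) (g : unitri n F) : biTranslate mu g 1 ∈ leftOrbit lam := by
  obtain ⟨k, rfl⟩ := h
  exact ⟨k * g, by simp [biTranslate_biTranslate]⟩

theorem vElt_mem_span {lam mu : Module.Dual F (strictUpper n F)} (h : mu ∈ leftOrbit lam) :
    vElt θ mu ∈ Ideal.span ({vElt θ lam} : Set (MonoidAlgebra ℂ (unitri n F))) := by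
  obtain ⟨k, rfl⟩ := h
  have h := single_mul_vElt (θ := θ) lam k⁻¹
  rw [inv_inv] at h
  rw [Ideal.mem_span_singleton']
  refine ⟨(θ (lam (unitriSubOne k)))⁻¹ • MonoidAlgebra.single k⁻¹ (1 : ℂ), ?_⟩
  rw [smul_mul_assoc, h, smul_smul, inv_mul_cancel₀ (addChar_ne_zero _ _), one_smul]

theorem mem_span_vElt {lam : Module.Dual F (strictUpper n F)} {a : MonoidAlgebra ℂ (unitri n F)}
    (h : a ∈ Ideal.span ({vElt θ lam} : Set (MonoidAlgebra ℂ (unitri n F)))) :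
    a ∈ Submodule.span ℂ (Set.range fun mu : leftOrbit lam => vElt θ mu.1) := by
  obtain ⟨b, rfl⟩ := Ideal.mem_span_singleton'.1 h
  induction b using MonoidAlgebra.induction_linear with
  | zero => simp
  | add x y hx hy =>
    rw [add_mul]
    exact add_mem (hx (Ideal.mul_mem_left _ _ (Ideal.mem_span_singleton_self _)))
      (hy (Ideal.mul_mem_left _ _ (Ideal.mem_span_singleton_self _)))
  | single g r =>
    have : MonoidAlgebra.single g r = r • MonoidAlgebra.single g (1 : ℂ) := by simp
    rw [this, smul_mul_assoc, single_mul_vElt]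
    refine Submodule.smul_mem _ _ (Submodule.smul_mem _ _ (Submodule.subset_span ?_))
    exact ⟨⟨_, g⁻¹, rfl⟩, rfl⟩

/-- The basis of `ℂG v_lam` consisting of the `v_mu`, for `mu` in the left orbit of `lam`. -/
noncomputable def vBasis (hθ : θ ≠ 1) (lam : Module.Dual F (strictUpper n F)) :
    Module.Basis (leftOrbit lam) ℂ
      (Ideal.span ({vElt θ lam} : Set (MonoidAlgebra ℂ (unitri n F)))) :=
  let I := Ideal.span ({vElt θ lam} : Set (MonoidAlgebra ℂ (unitri n F)))
  have hli : LinearIndependent ℂ fun mu : leftOrbit lam => (⟨vElt θ mu.1, vElt_mem_span mu.2⟩ : I) :=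
    LinearIndependent.of_comp (I.restrictScalars ℂ).subtype
      ((linearIndependent_vElt hθ).comp _ Subtype.val_injective)
  Module.Basis.mk hli (by
    rintro ⟨a, ha⟩ -
    have h := mem_span_vElt ha
    have himg : (Set.range fun mu : leftOrbit lam => vElt θ mu.1) =
        (I.restrictScalars ℂ).subtype ''
          Set.range fun mu : leftOrbit lam =>
            (⟨vElt θ mu.1, vElt_mem_span mu.2⟩ : I.restrictScalars ℂ) :=
      Set.range_comp (I.restrictScalars ℂ).subtype fun mu : leftOrbit lam =>
        (⟨vElt θ mu.1, vElt_mem_span mu.2⟩ : I.restrictScalars ℂ)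
    rw [himg, Submodule.span_image] at h
    obtain ⟨b, hb, rfl⟩ := h
    exact hb)

theorem coe_vBasis (hθ : θ ≠ 1) (lam : Module.Dual F (strictUpper n F)) (mu : leftOrbit lam) :
    (vBasis hθ lam mu : MonoidAlgebra ℂ (unitri n F)) = vElt θ mu.1 := by
  simp [vBasis]

-- In the basis `vBasis` the matrix of `g` is monomial, so only the `mu` fixed by translation by
-- `g⁻¹` contribute to the trace.
open Classical in
theorem moduleChar_eq_sum_leftOrbit (hθ : θ ≠ 1) (lam : Module.Dual F (strictUpper n F))
    (g : unitri n F) (inst : Fintype (leftOrbit lam)) :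
    moduleChar θ lam g = ∑ mu : leftOrbit lam,
      if biTranslate mu.1 g⁻¹ 1 = mu.1 then θ (mu.1 (unitriSubOne g⁻¹)) else 0 := by
  rw [moduleChar, Representation.character, LinearMap.trace_eq_matrix_trace ℂ (vBasis hθ lam),
    Matrix.trace]
  refine Finset.sum_congr rfl fun mu _ => ?_
  rw [Matrix.diag_apply, LinearMap.toMatrix_apply]
  have h : (Representation.ofModule' (k := ℂ) (G := unitri n F)
      (Ideal.span ({vElt θ lam} : Set (MonoidAlgebra ℂ (unitri n F)))) g) (vBasis hθ lam mu) =
      θ (mu.1 (unitriSubOne g⁻¹)) •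
        vBasis hθ lam ⟨biTranslate mu.1 g⁻¹ 1, biTranslate_mem_leftOrbit mu.2 _⟩ := by
    apply Subtype.ext
    have h1 := single_mul_vElt (θ := θ) mu.1 g
    simp only [Representation.ofModule', MonoidAlgebra.lift_symm_apply,
      Algebra.lsmul_coe, SetLike.val_smul, coe_vBasis, smul_eq_mul]
    refine h1.trans ?_
    rw [← coe_vBasis hθ lam ⟨biTranslate mu.1 g⁻¹ 1, biTranslate_mem_leftOrbit mu.2 _⟩]
    rfl
  rw [h, map_smul, Module.Basis.repr_self, Finsupp.smul_apply, Finsupp.single_apply]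
  simp only [Subtype.ext_iff, smul_eq_mul, mul_ite, mul_one, mul_zero]

/-- The number of `k` which fix `lam` under left translation. -/
noncomputable def stabCard (lam : Module.Dual F (strictUpper n F)) : ℕ :=
  Nat.card {k : unitri n F // biTranslate lam k 1 = lam}

theorem stabCard_ne_zero (lam : Module.Dual F (strictUpper n F)) : stabCard lam ≠ 0 := by
  have : Nonempty {k : unitri n F // biTranslate lam k 1 = lam} := ⟨⟨1, by simp⟩⟩
  exact Nat.card_pos.ne'

-- The fibres of `k ↦ biTranslate lam k 1` are cosets of the stabilizer of `lam`.
omit [Fintype F] in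
theorem stabCard_eq_card_fiber (lam : Module.Dual F (strictUpper n F)) (g : unitri n F) :
    Nat.card {k : unitri n F // biTranslate lam k 1 = biTranslate lam g 1} = stabCard lam := by
  refine Nat.card_congr ((Equiv.mulRight g⁻¹).subtypeEquiv fun k => ?_)
  constructor
  · intro h
    have := congrArg (fun mu => biTranslate mu g⁻¹ 1) h
    simpa [biTranslate_biTranslate] using this
  · intro h
    have := congrArg (fun mu => biTranslate mu g 1) h
    simpa [biTranslate_biTranslate] using this

theorem stabCard_mul_sum_leftOrbit (lam : Module.Dual F (strictUpper n F))
    [inst : Fintype (leftOrbit lam)] (f : Module.Dual F (strictUpper n F) → ℂ) :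
    (stabCard lam : ℂ) * ∑ mu : leftOrbit lam, f mu.1 = ∑ k : unitri n F, f (biTranslate lam k 1) := by
  classical
  rw [← Finset.sum_fiberwise (s := Finset.univ)
    (g := fun k : unitri n F => (⟨biTranslate lam k 1, k, rfl⟩ : leftOrbit lam)), Finset.mul_sum]
  refine Finset.sum_congr rfl fun mu _ => ?_
  obtain ⟨_, g, rfl⟩ := mu
  rw [Finset.sum_congr rfl (g := fun _ => f (biTranslate lam g 1))]
  · rw [Finset.sum_const, nsmul_eq_mul, ← stabCard_eq_card_fiber lam g, Nat.card_eq_fintype_card,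
      Fintype.card_subtype]
    simp [Subtype.ext_iff]
  · intro k hk
    have := congrArg Subtype.val (Finset.mem_filter.1 hk).2
    exact congrArg f this

/-- The sum `∑ θ(lam(k X h))` over all `k` and `h` in the unitriangular group. -/
noncomputable def orbitSum (θ : AddChar F ℂ) (lam : Module.Dual F (strictUpper n F))
    (X : strictUpper n F) : ℂ :=
  ∑ k : unitri n F, ∑ h : unitri n F, θ (biTranslate lam k h X)

/-- This trades the fixed-point condition in the trace for a sum over right translations. Since `(g
- 1)h = (g - 1)(h - 1) + (g - 1)`, the sum is a constant times the sum of an additive character in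
`h - 1`, which is trivial exactly when `g` fixes `mu`. -/
theorem sum_biTranslate_right (hθ : θ ≠ 1) [DecidableEq (Module.Dual F (strictUpper n F))]
    (mu : Module.Dual F (strictUpper n F)) (g : unitri n F) :
    ∑ h : unitri n F, θ (biTranslate mu 1 h (unitriSubOne g)) =
      (Fintype.card (unitri n F) : ℂ) *
        if biTranslate mu g 1 = mu then θ (mu (unitriSubOne g)) else 0 := by
  classical
  have key : ∀ h : unitri n F, biTranslate mu 1 h (unitriSubOne g) =
      (biTranslate mu g 1 - mu) (unitriSubOne h) + mu (unitriSubOne g) := by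
    intro h
    rw [LinearMap.sub_apply, biTranslate_apply, biTranslate_apply, ← map_sub, ← map_add]
    congr 1
    ext1
    simp only [coe_biMul, coe_unitriSubOne, mul_sub, sub_mul, Submodule.coe_add, Submodule.coe_sub,
      OneMemClass.coe_one, Units.val_one, mul_one, one_mul]
    abel
  simp_rw [key, AddChar.map_add_eq_mul]
  rw [← Finset.sum_mul, show ∑ h : unitri n F, θ ((biTranslate mu g 1 - mu) (unitriSubOne h)) =
    ∑ X, θ ((biTranslate mu g 1 - mu) X) from (subOneEquiv n F).sum_comp
      fun X => θ ((biTranslate mu g 1 - mu) X)]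
  have h := AddChar.sum_eq_ite (dualChar θ (biTranslate mu g 1 - mu))
  -- For additive characters `0` denotes the trivial character.
  have h0 : dualChar θ (biTranslate mu g 1 - mu) = 0 ↔ biTranslate mu g 1 = mu := by
    rw [← sub_eq_zero (a := biTranslate mu g 1), ← (dualChar_injective (n := n) hθ).eq_iff]
    have : dualChar θ (0 : Module.Dual F (strictUpper n F)) = 0 := by
      ext X
      simp [dualChar_apply]
    rw [this]
  simp only [h0] at h
  erw [h]
  rw [Fintype.card_congr (subOneEquiv n F)]
  split_ifs <;> simp

theorem moduleChar_eq_orbitSum (hθ : θ ≠ 1) (lam : Module.Dual F (strictUpper n F))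
    (g : unitri n F) :
    ((stabCard lam : ℂ) * Fintype.card (unitri n F)) * moduleChar θ lam g =
      orbitSum θ lam (unitriSubOne g⁻¹) := by
  classical
  rw [moduleChar_eq_sum_leftOrbit hθ lam g (Fintype.ofFinite _), mul_right_comm,
    stabCard_mul_sum_leftOrbit (inst := Fintype.ofFinite _) lam
      (fun mu => if biTranslate mu g⁻¹ 1 = mu then θ (mu (unitriSubOne g⁻¹)) else 0), mul_comm,
    Finset.mul_sum, orbitSum]
  refine Finset.sum_congr rfl fun k _ => ?_
  rw [← sum_biTranslate_right hθ]
  simp [biTranslate_biTranslate]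

theorem orbitSum_biTranslate (lam : Module.Dual F (strictUpper n F)) (g h : unitri n F)
    (X : strictUpper n F) : orbitSum θ (biTranslate lam g h) X = orbitSum θ lam X := by
  simp_rw [orbitSum, biTranslate_biTranslate]
  refine (Equiv.sum_comp (Equiv.mulLeft g)
    (fun k => ∑ h' : unitri n F, θ (biTranslate lam k (h' * h) X))).trans ?_
  refine Finset.sum_congr rfl fun k _ => ?_
  exact Equiv.sum_comp (Equiv.mulRight h) (fun h' => θ (biTranslate lam k h' X))

theorem orbitSum_biMul (lam : Module.Dual F (strictUpper n F)) (g h : unitri n F)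
    (X : strictUpper n F) : orbitSum θ lam (biMul g h X) = orbitSum θ lam X := by
  simp_rw [orbitSum, biTranslate_apply, biMul_biMul]
  refine (Equiv.sum_comp (Equiv.mulRight g)
    (fun k => ∑ h' : unitri n F, θ (lam (biMul k (h * h') X)))).trans ?_
  refine Finset.sum_congr rfl fun k _ => ?_
  exact Equiv.sum_comp (Equiv.mulLeft h) (fun h' => θ (lam (biMul k h' X)))

-- Right translation commutes with left translation, and left translation by `g` conjugates the
-- stabilizer.
omit [Fintype F] in
theorem stabCard_biTranslate (lam : Module.Dual F (strictUpper n F)) (g h : unitri n F) :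
    stabCard (biTranslate lam g h) = stabCard lam := by
  refine Nat.card_congr ((MulAut.conj g).toEquiv.subtypeEquiv fun k => ?_)
  simp only [biTranslate_biTranslate, MulEquiv.toEquiv_eq_coe, MulEquiv.coe_toEquiv,
    MulAut.conj_apply]
  constructor
  · intro e
    have := congrArg (fun mu => biTranslate mu g⁻¹ h⁻¹) e
    simpa [biTranslate_biTranslate] using this
  · intro e
    have := congrArg (fun mu => biTranslate mu g h) e
    simpa [biTranslate_biTranslate] using this

theorem superchar_eq_orbitSum (hθ : θ ≠ 1) (lam : Module.Dual F (strictUpper n F))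
    (g : unitri n F) :
    ((stabCard lam : ℂ) * Fintype.card (unitri n F)) * superchar θ lam g =
      orbitSum θ lam (unitriSubOne g) := by
  have h := congrArg (starRingEnd ℂ) (moduleChar_eq_orbitSum hθ lam g)
  rw [map_mul, map_mul, map_natCast, map_natCast] at h
  rw [superchar, h]
  -- Conjugation replaces `g⁻¹ - 1` by `1 - g⁻¹`, and `g(1 - g⁻¹) = g - 1` lies in the same
  -- two-sided orbit.
  have h2 : unitriSubOne g = biMul g 1 (-unitriSubOne g⁻¹) := by
    ext1
    simp [coe_biMul, coe_unitriSubOne, mul_sub]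
  rw [h2, orbitSum_biMul]
  simp only [orbitSum, map_sum]
  refine Finset.sum_congr rfl fun k _ => Finset.sum_congr rfl fun h' _ => ?_
  rw [map_neg, AddChar.map_neg_eq_conj]

theorem stabCard_mul_card_ne_zero (lam : Module.Dual F (strictUpper n F)) :
    (stabCard lam : ℂ) * Fintype.card (unitri n F) ≠ 0 :=
  mul_ne_zero (Nat.cast_ne_zero.2 (stabCard_ne_zero lam))
    (Nat.cast_ne_zero.2 Fintype.card_ne_zero)

theorem superchar_eq_of_sameOrbit (hθ : θ ≠ 1) {lam mu : Module.Dual F (strictUpper n F)}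
    (h : SameOrbit lam mu) : superchar θ lam = superchar θ mu := by
  obtain ⟨g, k, rfl⟩ := h
  ext x
  refine mul_left_cancel₀ (stabCard_mul_card_ne_zero lam) ?_
  rw [superchar_eq_orbitSum hθ, ← orbitSum_biTranslate lam g k, ← superchar_eq_orbitSum hθ,
    stabCard_biTranslate]

/-! ### Supercharacters and two-sided orbits. -/

theorem sum_orbitSum_mul (hθ : θ ≠ 1) (lam mu : Module.Dual F (strictUpper n F)) :
    ∑ X : strictUpper n F, orbitSum θ lam X * θ (-mu X) =
      (Nat.card {p : unitri n F × unitri n F // biTranslate lam p.1 p.2 = mu} : ℂ) *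
        Fintype.card (strictUpper n F) := by
  classical
  simp_rw [orbitSum, ← Fintype.sum_prod_type', Finset.sum_mul]
  rw [Finset.sum_comm, Nat.card_eq_fintype_card, Fintype.card_subtype, Finset.card_filter,
    Nat.cast_sum, Finset.sum_mul]
  refine Finset.sum_congr rfl fun p _ => ?_
  have h := AddChar.sum_eq_ite (dualChar θ (biTranslate lam p.1 p.2 - mu))
  have h0 : dualChar θ (biTranslate lam p.1 p.2 - mu) = 0 ↔ biTranslate lam p.1 p.2 = mu := by
    rw [← sub_eq_zero (a := biTranslate lam p.1 p.2), ← (dualChar_injective (n := n) hθ).eq_iff]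
    have : dualChar θ (0 : Module.Dual F (strictUpper n F)) = 0 := by
      ext X
      simp [dualChar_apply]
    rw [this]
  simp only [h0] at h
  simp_rw [← AddChar.map_add_eq_mul, ← sub_eq_add_neg, ← LinearMap.sub_apply]
  erw [h]
  split_ifs <;> simp

/-- The Fourier coefficient of `orbitSum θ lam` at `mu` counts the pairs of translations taking
`lam` to `mu`, so it is nonzero exactly when `mu` is in the orbit of `lam`. Equal supercharacters
have proportional orbit sums, hence the same nonvanishing coefficients. -/
theorem superchar_eq_iff (hθ : θ ≠ 1) {lam mu : Module.Dual F (strictUpper n F)} :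
    superchar θ lam = superchar θ mu ↔ SameOrbit lam mu := by
  refine ⟨fun h => ?_, superchar_eq_of_sameOrbit hθ⟩
  have hsum : ∀ nu : Module.Dual F (strictUpper n F),
      ∑ X : strictUpper n F, orbitSum θ nu X * θ (-mu X) =
      ((stabCard nu : ℂ) * Fintype.card (unitri n F)) *
        ∑ g : unitri n F, superchar θ nu g * θ (-mu (unitriSubOne g)) := by
    intro nu
    rw [← (subOneEquiv n F).sum_comp, Finset.mul_sum]
    refine Finset.sum_congr rfl fun g _ => ?_
    rw [← mul_assoc, superchar_eq_orbitSum hθ]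
    rfl
  have hne : ∀ nu : Module.Dual F (strictUpper n F),
      Nonempty {p : unitri n F × unitri n F // biTranslate nu p.1 p.2 = mu} ↔
      ∑ X : strictUpper n F, orbitSum θ nu X * θ (-mu X) ≠ 0 := by
    intro nu
    rw [sum_orbitSum_mul hθ, ← Finite.card_pos_iff, Nat.pos_iff_ne_zero, ne_eq, ne_eq, mul_eq_zero,
      Nat.cast_eq_zero, Nat.cast_eq_zero, or_iff_left Fintype.card_ne_zero]
  have h1 : ∑ X : strictUpper n F, orbitSum θ mu X * θ (-mu X) ≠ 0 :=
    (hne mu).1 ⟨⟨(1, 1), by simp⟩⟩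
  rw [hsum, ← h] at h1
  have h2 : ∑ X : strictUpper n F, orbitSum θ lam X * θ (-mu X) ≠ 0 := by
    rw [hsum]
    exact mul_ne_zero (stabCard_mul_card_ne_zero _) (right_ne_zero_of_mul h1)
  obtain ⟨⟨⟨g, k⟩, hp⟩⟩ := (hne lam).2 h2
  exact ⟨g, k, hp.symm⟩

/-- Conjugation only permutes the supercharacters, so the set defined through `moduleChar` is also
the range of `superchar`. -/
theorem superchar_eq_moduleChar_neg (hθ : θ ≠ 1) (lam : Module.Dual F (strictUpper n F)) :
    superchar θ lam = moduleChar θ (-lam) := by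
  ext g
  have hstab : stabCard (-lam) = stabCard lam := by
    refine Nat.card_congr (Equiv.subtypeEquivRight fun k => ?_)
    rw [← neg_inj (a := biTranslate lam k 1)]
    rfl
  refine mul_left_cancel₀ (stabCard_mul_card_ne_zero lam) ?_
  have h := moduleChar_eq_orbitSum hθ (-lam) g
  rw [hstab] at h
  rw [h, superchar_eq_orbitSum hθ]
  have h2 : unitriSubOne g = biMul g 1 (-unitriSubOne g⁻¹) := by
    ext1
    simp [coe_biMul, coe_unitriSubOne, mul_sub]
  rw [h2, orbitSum_biMul]
  simp [orbitSum, biTranslate_apply]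

theorem mem_supercharacters_iff (hθ : θ ≠ 1) {χ : unitri n F → ℂ} :
    χ ∈ supercharacters n θ ↔ ∃ lam, superchar θ lam = χ := by
  constructor
  · rintro ⟨lam, rfl⟩
    exact ⟨-lam, by rw [superchar_eq_moduleChar_neg hθ, neg_neg]⟩
  · rintro ⟨lam, rfl⟩
    exact ⟨-lam, (superchar_eq_moduleChar_neg hθ lam).symm⟩

/-- A translation-invariant `s` contributes the same factor `θ(s(g - 1))` to every term of the orbit
sum and does not change the stabilizer. -/
theorem superchar_add_invariant (hθ : θ ≠ 1) (lam s : Module.Dual F (strictUpper n F))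
    (hs : ∀ g h, biTranslate s g h = s) (g : unitri n F) :
    superchar θ (lam + s) g = θ (s (unitriSubOne g)) * superchar θ lam g := by
  have hadd : ∀ k h, biTranslate (lam + s) k h = biTranslate lam k h + s := by
    intro k h
    rw [show biTranslate (lam + s) k h = biTranslate lam k h + biTranslate s k h from rfl, hs]
  have hstab : stabCard (lam + s) = stabCard lam := by
    refine Nat.card_congr (Equiv.subtypeEquivRight fun k => ?_)
    rw [hadd, add_left_inj]
  refine mul_left_cancel₀ (stabCard_mul_card_ne_zero lam) ?_
  have h := superchar_eq_orbitSum hθ (lam + s) g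
  rw [hstab] at h
  rw [h, mul_left_comm, superchar_eq_orbitSum hθ]
  simp only [orbitSum, hadd, LinearMap.add_apply, AddChar.map_add_eq_mul, Finset.mul_sum]
  refine Finset.sum_congr rfl fun k _ => Finset.sum_congr rfl fun h' _ => mul_comm _ _

end ModuleChar

/-! ### Arcs of set partitions -/

section Arcs

variable {n : ℕ} (P : SetPartition n)

theorem SetPartition.exists_block (i : Fin n) : ∃ B ∈ P.parts, i ∈ B :=
  P.exists_mem (Finset.mem_univ i)

theorem SetPartition.exists_arc_of_lt {B : Finset (Fin n)} (hB : B ∈ P.parts) {i j : Fin n}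
    (hi : i ∈ B) (hj : j ∈ B) (h : i < j) : ∃ k ∈ B, P.IsArc i k ∧ k ≤ j := by
  have hne : (B.filter (i < ·)).Nonempty := ⟨j, by simp [hj, h]⟩
  have hm := Finset.min'_mem _ hne
  rw [Finset.mem_filter] at hm
  refine ⟨_, hm.1, ⟨B, hB, hi, hm.1, hm.2, fun k hk hik => ?_⟩, ?_⟩ <;>
  exact Finset.min'_le _ _ (by simp [*])

theorem SetPartition.exists_arc_of_gt {B : Finset (Fin n)} (hB : B ∈ P.parts) {i j : Fin n}
    (hi : i ∈ B) (hj : j ∈ B) (h : i < j) : ∃ k ∈ B, P.IsArc k j := by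
  have hne : (B.filter (· < j)).Nonempty := ⟨i, by simp [hi, h]⟩
  have hm := Finset.max'_mem _ hne
  rw [Finset.mem_filter] at hm
  refine ⟨_, hm.1, ⟨B, hB, hm.1, hj, hm.2, fun k hk hik => ?_⟩⟩
  by_contra! hkj
  exact absurd (Finset.le_max' _ k (by simp [hk, hkj])) (not_le.2 hik)

/-- An element of a block with at least two elements has a neighbour in it, and the consecutive
elements of a block are joined by arcs. -/
theorem SetPartition.isFeasible_iff :
    P.IsFeasible ↔ ∀ k, (∃ j, P.IsArc k j) ∨ ∃ i, P.IsArc i k := by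
  constructor
  · intro h k
    obtain ⟨B, hB, hk⟩ := P.exists_block k
    obtain ⟨j, hj, hjk⟩ := Finset.exists_mem_ne (h B hB) k
    rcases lt_or_gt_of_ne hjk with hlt | hlt
    · obtain ⟨i, -, hi⟩ := P.exists_arc_of_gt hB hj hk hlt
      exact Or.inr ⟨i, hi⟩
    · obtain ⟨i, -, hi, -⟩ := P.exists_arc_of_lt hB hk hj hlt
      exact Or.inl ⟨i, hi⟩
  · intro h B hB
    obtain ⟨k, hk⟩ := P.nonempty_of_mem_parts hB
    apply Finset.one_lt_card.2
    rcases h k with ⟨j, B', hB', hk', hj, hlt, -⟩ | ⟨i, B', hB', hi, hk', hlt, -⟩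
    · obtain rfl : B = B' := P.eq_of_mem_parts hB hB' hk hk'
      exact ⟨k, hk, j, hj, hlt.ne⟩
    · obtain rfl : B = B' := P.eq_of_mem_parts hB hB' hk hk'
      exact ⟨i, hi, k, hk, hlt.ne⟩

/-- Arcs link each block into a path, so the blocks are the connected components of the arc graph,
and the arcs determine the partition. -/
theorem SetPartition.eqvGen_isArc (i j : Fin n) :
    Relation.EqvGen P.IsArc i j ↔ ∃ B ∈ P.parts, i ∈ B ∧ j ∈ B := by
  constructor
  · intro h
    induction h with
    | rel x y h =>
      obtain ⟨B, hB, hx, hy, -⟩ := h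
      exact ⟨B, hB, hx, hy⟩
    | refl x =>
      obtain ⟨B, hB, hx⟩ := P.exists_block x
      exact ⟨B, hB, hx, hx⟩
    | symm x y _ ih =>
      obtain ⟨B, hB, hx, hy⟩ := ih
      exact ⟨B, hB, hy, hx⟩
    | trans x y z _ _ ih1 ih2 =>
      obtain ⟨B, hB, hx, hy⟩ := ih1
      obtain ⟨B', hB', hy', hz⟩ := ih2
      obtain rfl : B = B' := P.eq_of_mem_parts hB hB' hy hy'
      exact ⟨B, hB, hx, hz⟩
  · rintro ⟨B, hB, hi, hj⟩
    have key : ∀ i ∈ B, ∀ j ∈ B, i ≤ j → Relation.EqvGen P.IsArc i j := by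
      intro i hi j
      induction j using WellFoundedLT.induction with
      | ind j ih =>
        intro hj hij
        rcases hij.eq_or_lt with rfl | hlt
        · exact .refl _
        · obtain ⟨k, hk, hkj⟩ := P.exists_arc_of_gt hB hi hj hlt
          have hkj' := hkj
          obtain ⟨B', hB', hk', hj', h, hmin⟩ := hkj'
          obtain rfl : B = B' := P.eq_of_mem_parts hB hB' hk hk'
          refine .trans _ _ _ (ih k h hk ?_) (.rel _ _ hkj)
          -- If the predecessor `k` of `j` were below `i`, the arc from `k` would have to end at or
          -- before `i`, but it ends at `j > i`.
          by_contra! hki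
          exact absurd (hmin i hi hki) (not_le.2 hlt)
    rcases le_total i j with h | h
    · exact key i hi j hj h
    · exact .symm _ _ (key j hj i hi h)

theorem SetPartition.mem_parts_iff (B : Finset (Fin n)) :
    B ∈ P.parts ↔ ∃ i, ∀ j, j ∈ B ↔ Relation.EqvGen P.IsArc i j := by
  constructor
  · intro hB
    obtain ⟨i, hi⟩ := P.nonempty_of_mem_parts hB
    refine ⟨i, fun j => ?_⟩
    rw [P.eqvGen_isArc]
    constructor
    · exact fun hj => ⟨B, hB, hi, hj⟩
    · rintro ⟨B', hB', hi', hj⟩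
      rwa [P.eq_of_mem_parts hB hB' hi hi']
  · rintro ⟨i, h⟩
    obtain ⟨B', hB', hi⟩ := P.exists_block i
    convert hB'
    ext j
    rw [h, P.eqvGen_isArc]
    constructor
    · rintro ⟨B'', hB'', hi', hj⟩
      rwa [P.eq_of_mem_parts hB' hB'' hi hi']
    · exact fun hj => ⟨B', hB', hi, hj⟩

theorem SetPartition.ext_isArc {P Q : SetPartition n} (h : ∀ i j, P.IsArc i j ↔ Q.IsArc i j) :
    P = Q := by
  have h' : P.IsArc = Q.IsArc := by
    ext i j
    exact h i j
  apply Finpartition.ext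
  ext B
  rw [P.mem_parts_iff, Q.mem_parts_iff, h']

/-- Each arc is determined by its left endpoint, and the points that are not left endpoints are the
block maxima, one per block. -/
theorem SetPartition.card_arcs_add_card_parts :
    Nat.card {a : Fin n × Fin n // P.IsArc a.1 a.2} + P.parts.card = n := by
  classical
  have h1 : Nat.card {a : Fin n × Fin n // P.IsArc a.1 a.2} =
      Nat.card {i : Fin n // ∃ j, P.IsArc i j} := by
    refine Nat.card_congr (Equiv.ofBijective (fun a => ⟨a.1.1, a.1.2, a.2⟩) ⟨?_, ?_⟩)
    · rintro ⟨⟨i, j⟩, h⟩ ⟨⟨i', j'⟩, h'⟩ e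
      obtain rfl : i = i' := congrArg Subtype.val e
      obtain rfl : j = j' := SetPartition.IsArc.right_unique h h'
      rfl
    · rintro ⟨i, j, h⟩
      exact ⟨⟨(i, j), h⟩, rfl⟩
  have h2 : P.parts.card = Nat.card {i : Fin n // ¬ ∃ j, P.IsArc i j} := by
    rw [← Nat.card_eq_finsetCard P.parts]
    refine Nat.card_congr (Equiv.ofBijective
      (fun B => ⟨B.1.max' (P.nonempty_of_mem_parts B.2), ?_⟩) ⟨?_, ?_⟩)
    · rintro ⟨j, B', hB', hi, hj, hlt, -⟩
      have := P.eq_of_mem_parts B.2 hB' (Finset.max'_mem _ (P.nonempty_of_mem_parts B.2)) hi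
      subst this
      exact absurd (Finset.le_max' _ _ hj) (not_le.2 hlt)
    · rintro ⟨B, hB⟩ ⟨B', hB'⟩ e
      have e' := congrArg Subtype.val e
      simp only at e'
      have hm := Finset.max'_mem B' (P.nonempty_of_mem_parts hB')
      rw [← e'] at hm
      exact Subtype.ext (P.eq_of_mem_parts hB hB' (Finset.max'_mem _ _) hm)
    · rintro ⟨i, hi⟩
      obtain ⟨B, hB, hiB⟩ := P.exists_block i
      refine ⟨⟨B, hB⟩, Subtype.ext ?_⟩
      refine le_antisymm (Finset.max'_le _ (P.nonempty_of_mem_parts hB) _ fun j hj => ?_) (Finset.le_max' _ _ hiB)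
      by_contra! hlt
      obtain ⟨k, -, hk, -⟩ := P.exists_arc_of_lt hB hiB hj hlt
      exact hi ⟨k, hk⟩
  rw [h1, h2, Nat.card_eq_fintype_card, Nat.card_eq_fintype_card,
    Fintype.card_subtype_compl, Fintype.card_fin]
  exact Nat.add_sub_of_le ((Fintype.card_subtype_le _).trans (by simp))

end Arcs

/-! ### Labeled partitions as matrices -/

section Rook

variable {n : ℕ} {F : Type*} [Field F]

/-- A strictly upper triangular matrix with at most one nonzero entry in each row and column. -/
structure IsRook (L : Matrix (Fin n) (Fin n) F) : Prop where
  lt : ∀ {i j}, L i j ≠ 0 → i < j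
  row : ∀ {i j k}, L i j ≠ 0 → L i k ≠ 0 → j = k
  col : ∀ {i j k}, L i k ≠ 0 → L j k ≠ 0 → i = j

open Classical in
/-- The matrix whose nonzero entries are the labels of the arcs. -/
noncomputable def LabeledPartition.toMatrix (Λ : LabeledPartition n F) :
    Matrix (Fin n) (Fin n) F :=
  fun i j => if h : Λ.part.IsArc i j then (Λ.label ⟨(i, j), h⟩ : F) else 0

theorem LabeledPartition.toMatrix_of_isArc (Λ : LabeledPartition n F) {i j : Fin n}
    (h : Λ.part.IsArc i j) : Λ.toMatrix i j = Λ.label ⟨(i, j), h⟩ := dif_pos h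

theorem LabeledPartition.toMatrix_ne_zero_iff (Λ : LabeledPartition n F) {i j : Fin n} :
    Λ.toMatrix i j ≠ 0 ↔ Λ.part.IsArc i j := by
  constructor
  · intro h
    by_contra hn
    exact h (dif_neg hn)
  · intro h
    rw [Λ.toMatrix_of_isArc h]
    exact Units.ne_zero _

theorem LabeledPartition.isRook_toMatrix (Λ : LabeledPartition n F) : IsRook Λ.toMatrix where
  lt h := by
    obtain ⟨_, _, _, _, h, _⟩ := Λ.toMatrix_ne_zero_iff.1 h
    exact h
  row h h' := (Λ.toMatrix_ne_zero_iff.1 h).right_unique (Λ.toMatrix_ne_zero_iff.1 h')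
  col h h' := (Λ.toMatrix_ne_zero_iff.1 h).left_unique (Λ.toMatrix_ne_zero_iff.1 h')

theorem LabeledPartition.toMatrix_injective :
    Function.Injective (LabeledPartition.toMatrix (n := n) (F := F)) := by
  rintro ⟨P, l⟩ ⟨Q, m⟩ h
  have hPQ : P = Q := SetPartition.ext_isArc fun i j => by
    have h1 := (LabeledPartition.mk P l).toMatrix_ne_zero_iff (i := i) (j := j)
    rw [h] at h1
    exact h1.symm.trans (LabeledPartition.mk Q m).toMatrix_ne_zero_iff
  subst hPQ
  congr
  ext ⟨⟨i, j⟩, ha⟩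
  rw [← (LabeledPartition.mk P l).toMatrix_of_isArc ha, h]
  exact (LabeledPartition.mk P m).toMatrix_of_isArc ha

theorem IsRook.exists_labeledPartition {L : Matrix (Fin n) (Fin n) F} (hL : IsRook L) :
    ∃ Λ : LabeledPartition n F, Λ.toMatrix = L := by
  have harc : ∀ i j, (SetPartition.ofArcs fun i j => L i j ≠ 0).IsArc i j ↔ L i j ≠ 0 :=
    SetPartition.isArc_ofArcs (fun _ _ h => hL.lt h) (fun _ _ _ h h' => hL.row h h')
      (fun _ _ _ h h' => hL.col h h')
  refine ⟨⟨SetPartition.ofArcs fun i j => L i j ≠ 0,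
    fun a => Units.mk0 (L a.1.1 a.1.2) ((harc _ _).1 a.2)⟩, ?_⟩
  ext i j
  by_cases h : L i j = 0
  · rw [h]
    by_contra hne
    exact (harc _ _).1 (LabeledPartition.toMatrix_ne_zero_iff _ |>.1 hne) h
  · rw [LabeledPartition.toMatrix_of_isArc _ ((harc i j).2 h)]
    rfl

theorem LabeledPartition.toMatrix_shift (Λ : LabeledPartition n F) (i j : Fin n) :
    Λ.shift.toMatrix i.castSucc j.succ = Λ.toMatrix i j := by
  have hiff : Λ.shift.part.IsArc i.castSucc j.succ ↔ Λ.part.IsArc i j := by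
    rw [Λ.isArc_shift_iff]
    constructor
    · rintro ⟨i', j', h, hi, hj⟩
      rwa [Fin.castSucc_injective _ hi, Fin.succ_injective _ hj]
    · exact fun h => ⟨i, j, h, rfl, rfl⟩
  by_cases h : Λ.part.IsArc i j
  · rw [Λ.shift.toMatrix_of_isArc (hiff.2 h), Λ.toMatrix_of_isArc h]
    rfl
  · have h1 := not_imp_comm.1 Λ.toMatrix_ne_zero_iff.1 h
    have h2 := not_imp_comm.1 Λ.shift.toMatrix_ne_zero_iff.1 (hiff.not.2 h)
    rw [h1, h2]

theorem LabeledPartition.toMatrix_shift_injective :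
    Function.Injective fun Λ : LabeledPartition n F => Λ.shift.toMatrix := by
  intro Λ Λ' h
  apply LabeledPartition.toMatrix_injective
  ext i j
  rw [← Λ.toMatrix_shift, ← Λ'.toMatrix_shift]
  exact congrFun (congrFun h _) _

/-- Position `(k, k + 1)` has a nonzero entry to its right or above it. -/
def IsCoveredAt (M : Matrix (Fin (n + 1)) (Fin (n + 1)) F) (k : Fin n) : Prop :=
  (∃ j, k.succ < j ∧ M k.castSucc j ≠ 0) ∨ ∃ i, i < k.castSucc ∧ M i k.succ ≠ 0

/-- An arc `(k, j)` moves to `(k, j + 1)`, right of `(k, k + 1)`; an arc `(i, k)` moves to `(i, k +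
1)`, above it. -/
theorem LabeledPartition.isCoveredAt_shift {Λ : LabeledPartition n F}
    (h : Λ.part.IsFeasible) (k : Fin n) : IsCoveredAt Λ.shift.toMatrix k := by
  rcases (SetPartition.isFeasible_iff _).1 h k with ⟨j, hj⟩ | ⟨i, hi⟩
  · refine Or.inl ⟨j.succ, ?_, ?_⟩
    · exact Fin.succ_lt_succ_iff.2 (Λ.isRook_toMatrix.lt (Λ.toMatrix_ne_zero_iff.2 hj))
    · rw [Λ.toMatrix_shift]
      exact Λ.toMatrix_ne_zero_iff.2 hj
  · refine Or.inr ⟨i.castSucc, ?_, ?_⟩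
    · exact Fin.castSucc_lt_castSucc_iff.2 (Λ.isRook_toMatrix.lt (Λ.toMatrix_ne_zero_iff.2 hi))
    · rw [Λ.toMatrix_shift]
      exact Λ.toMatrix_ne_zero_iff.2 hi

theorem IsRook.exists_shift {M : Matrix (Fin (n + 1)) (Fin (n + 1)) F} (hM : IsRook M)
    (hc : ∀ k, IsCoveredAt M k) :
    ∃ Λ : LabeledPartition n F, Λ.part.IsFeasible ∧ Λ.shift.toMatrix = M := by
  -- A nonzero superdiagonal entry would share its row or column with the entry that covers it.
  have hsd : ∀ k : Fin n, M k.castSucc k.succ = 0 := by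
    intro k
    by_contra h
    rcases hc k with ⟨j, hj, hne⟩ | ⟨i, hi, hne⟩
    · exact hj.ne (hM.row h hne)
    · exact hi.ne (hM.col hne h)
  -- Deleting the last row and the first column undoes the shift; `hsd` makes the result strictly
  -- upper triangular.
  let L : Matrix (Fin n) (Fin n) F := fun i j => M i.castSucc j.succ
  have hL : IsRook L :=
    { lt := fun {i j} h => by
        have h1 : (i : ℕ) < j + 1 := by simpa [Fin.lt_def] using hM.lt h
        have h2 : i ≠ j := by
          rintro rfl
          exact h (hsd i)
        rw [Fin.lt_def]
        have := Fin.val_ne_of_ne h2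
        omega
      row := fun h h' => Fin.succ_injective _ (hM.row h h')
      col := fun h h' => Fin.castSucc_injective _ (hM.col h h') }
  obtain ⟨Λ, hΛ⟩ := hL.exists_labeledPartition
  refine ⟨Λ, (SetPartition.isFeasible_iff _).2 fun k => ?_, ?_⟩
  · simp_rw [← Λ.toMatrix_ne_zero_iff, hΛ]
    rcases hc k with ⟨j, hj, hne⟩ | ⟨i, hi, hne⟩
    · obtain ⟨j', rfl⟩ := Fin.exists_succ_eq.2 (Fin.ne_zero_of_lt hj)
      exact Or.inl ⟨j', hne⟩
    · obtain ⟨i', rfl⟩ := Fin.exists_castSucc_eq.2 (Fin.ne_last_of_lt hi)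
      exact Or.inr ⟨i', hne⟩
  · ext a b
    by_cases ha : a = Fin.last n
    · subst ha
      have h1 : ∀ N : Matrix (Fin (n + 1)) (Fin (n + 1)) F, IsRook N → N (Fin.last n) b = 0 := by
        intro N hN
        by_contra h
        exact absurd (hN.lt h) (not_lt.2 (Fin.le_last b))
      rw [h1 _ hM, h1 _ Λ.shift.isRook_toMatrix]
    by_cases hb : b = 0
    · subst hb
      have h1 : ∀ N : Matrix (Fin (n + 1)) (Fin (n + 1)) F, IsRook N → N a 0 = 0 := by
        intro N hN
        by_contra h
        exact absurd (hN.lt h) (not_lt.2 (Fin.zero_le a))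
      rw [h1 _ hM, h1 _ Λ.shift.isRook_toMatrix]
    obtain ⟨i, rfl⟩ := Fin.exists_castSucc_eq.2 ha
    obtain ⟨j, rfl⟩ := Fin.exists_succ_eq.2 hb
    rw [Λ.toMatrix_shift, hΛ]

end Rook

/-! ### Counting feasible labeled partitions -/

/-- Feasible labeled partitions as dependent pairs. -/
def feasibleLabeledEquiv (n : ℕ) (F : Type*) [Field F] :
    {Λ : LabeledPartition n F | Λ.part.IsFeasible} ≃
      Σ P : {P : SetPartition n // P.IsFeasible}, ({a : Fin n × Fin n // P.1.IsArc a.1 a.2} → Fˣ) where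
  toFun Λ := ⟨⟨Λ.1.part, Λ.2⟩, Λ.1.label⟩
  invFun p := ⟨⟨p.1.1, p.2⟩, p.1.2⟩
  left_inv _ := rfl
  right_inv _ := rfl

theorem ncard_feasible (n : ℕ) (F : Type*) [Field F] [Fintype F] :
    (({Λ : LabeledPartition n F | Λ.part.IsFeasible}.ncard : ℕ) : ℤ) =
      (feasiblePoly n).eval ((Fintype.card F : ℤ) - 1) := by
  classical
  have hq : ((Fintype.card F - 1 : ℕ) : ℤ) = (Fintype.card F : ℤ) - 1 := by
    rw [Nat.cast_sub Fintype.card_pos, Nat.cast_one]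
  rw [← Nat.card_coe_set_eq, Nat.card_congr (feasibleLabeledEquiv n F), Nat.card_sigma,
    feasiblePoly, Polynomial.eval_finsetSum]
  have hterm : ∀ P : {P : SetPartition n // P.IsFeasible},
      Nat.card ({a : Fin n × Fin n // P.1.IsArc a.1 a.2} → Fˣ) =
        (Fintype.card F - 1) ^ (n - P.1.parts.card) := by
    intro P
    rw [Nat.card_fun, Nat.card_units, Nat.card_eq_fintype_card]
    congr 1
    -- The exponent is the number of arcs.
    have := P.1.card_arcs_add_card_parts
    omega
  simp_rw [hterm]
  rw [← Finset.sum_fiberwise_of_maps_to (t := Finset.range (n + 1))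
    (g := fun P : {P : SetPartition n // P.IsFeasible} => P.1.parts.card), Nat.cast_sum]
  · refine Finset.sum_congr rfl fun k _ => ?_
    rw [Finset.sum_congr rfl (g := fun _ => (Fintype.card F - 1) ^ (n - k))]
    · rw [Finset.sum_const, Polynomial.eval_mul, Polynomial.eval_C, Polynomial.eval_pow,
        Polynomial.eval_X, smul_eq_mul, Nat.cast_mul, Nat.cast_pow, hq, assocStirling,
        ← Fintype.card_subtype, ← Nat.card_eq_fintype_card,
        Nat.card_congr (Equiv.subtypeSubtypeEquivSubtypeInter (fun P : SetPartition n =>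
          P.IsFeasible) (fun P => P.parts.card = k))]
    · intro P hP
      rw [(Finset.mem_filter.1 hP).2]
  · intro P _
    have := P.1.card_arcs_add_card_parts
    rw [Finset.mem_range]
    omega

/-! ### Functionals as matrices -/

section DualOf

variable {n : ℕ} {F : Type*} [Field F]

/-- The functional `X ↦ ∑ L i j * X i j`. -/
def dualOf (L : Matrix (Fin n) (Fin n) F) : Module.Dual F (strictUpper n F) where
  toFun X := ∑ i, ∑ j, L i j * X.1 i j
  map_add' X Y := by simp [mul_add, Finset.sum_add_distrib]
  map_smul' c X := by
    simp only [Submodule.coe_smul, Matrix.smul_apply, smul_eq_mul, RingHom.id_apply,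
      Finset.mul_sum]
    exact Finset.sum_congr rfl fun i _ => Finset.sum_congr rfl fun j _ => by ring

theorem dualOf_apply (L : Matrix (Fin n) (Fin n) F) (X : strictUpper n F) :
    dualOf L X = ∑ i, ∑ j, L i j * X.1 i j := rfl

theorem dualOf_eq_trace (L : Matrix (Fin n) (Fin n) F) (X : strictUpper n F) :
    dualOf L X = (L.transpose * X.1).trace := by
  rw [dualOf_apply, Finset.sum_comm]
  rfl

theorem dualOf_add (L M : Matrix (Fin n) (Fin n) F) : dualOf (L + M) = dualOf L + dualOf M := by
  ext X
  simp [dualOf_apply, add_mul, Finset.sum_add_distrib]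

theorem dualOf_eq_iff {L M : Matrix (Fin n) (Fin n) F} :
    dualOf L = dualOf M ↔ ∀ i j, i < j → L i j = M i j := by
  constructor
  · intro h i j hij
    let X : strictUpper n F := ⟨Matrix.single i j 1, fun a b hba => by
      rw [Matrix.single_apply, if_neg]
      rintro ⟨rfl, rfl⟩
      exact absurd hij (not_lt.2 hba)⟩
    have hX : ∀ N : Matrix (Fin n) (Fin n) F, dualOf N X = N i j := by
      intro N
      rw [dualOf_apply, Finset.sum_eq_single i, Finset.sum_eq_single j] <;>
        simp +contextual [X, Matrix.single_apply, eq_comm]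
    exact (hX L).symm.trans ((LinearMap.congr_fun h X).trans (hX M))
  · intro h
    ext X
    rw [dualOf_apply, dualOf_apply]
    refine Finset.sum_congr rfl fun i _ => Finset.sum_congr rfl fun j _ => ?_
    rcases lt_or_ge i j with hij | hij
    · rw [h i j hij]
    · rw [X.2 i j hij, mul_zero, mul_zero]

theorem exists_dualOf_eq (lam : Module.Dual F (strictUpper n F)) : ∃ L, dualOf L = lam := by
  obtain ⟨f, hf⟩ := LinearMap.exists_extend lam
  refine ⟨Matrix.of fun i j => f (Matrix.single i j 1), ?_⟩
  ext X
  have h : lam X = f X.1 := by rw [← hf]; rfl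
  rw [h, Matrix.matrix_eq_sum_single X.1, map_sum, dualOf_apply]
  refine Finset.sum_congr rfl fun i _ => ?_
  rw [map_sum]
  refine Finset.sum_congr rfl fun j _ => ?_
  have hs : Matrix.single i j (X.1 i j) = X.1 i j • Matrix.single i j (1 : F) := by
    rw [Matrix.smul_single, smul_eq_mul, mul_one]
  rw [hs, map_smul, smul_eq_mul, mul_comm, Matrix.of_apply]

theorem biTranslate_dualOf (L : Matrix (Fin n) (Fin n) F) (g h : unitri n F) :
    biTranslate (dualOf L) g h = dualOf (g.1.1.transpose * L * h.1.1.transpose) := by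
  ext X
  rw [biTranslate_apply, dualOf_eq_trace, dualOf_eq_trace, coe_biMul, Matrix.transpose_mul,
    Matrix.transpose_mul, Matrix.transpose_transpose, Matrix.transpose_transpose, ← mul_assoc,
    Matrix.trace_mul_comm]
  simp only [mul_assoc]

/-- Adding multiples of column `j` to columns on its left. -/
theorem sameOrbit_add_column {L M : Matrix (Fin n) (Fin n) F} (j : Fin n) (c : Fin n → F)
    (hM : ∀ a b, M a b = L a b + if b < j then L a j * c b else 0) :
    SameOrbit (dualOf L) (dualOf M) := by
  let X : strictUpper n F := ⟨fun a b => if b = j ∧ a < j then c a else 0, fun a b hab => by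
    refine if_neg ?_
    rintro ⟨rfl, h⟩
    exact absurd h (not_lt.2 hab)⟩
  have hX : ∀ a b, X.1 a b = if b = j ∧ a < j then c a else 0 := fun _ _ => rfl
  refine ⟨1, oneAdd X, ?_⟩
  rw [biTranslate_dualOf, coe_oneAdd]
  congr 1
  ext a b
  rw [hM, OneMemClass.coe_one, Units.val_one, Matrix.transpose_one, one_mul,
    Matrix.transpose_add, mul_add, Matrix.transpose_one, mul_one, Matrix.add_apply,
    Matrix.mul_apply]
  congr 1
  rw [Finset.sum_eq_single j]
  · simp [Matrix.transpose_apply, hX]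
  · intro k _ hk
    simp [Matrix.transpose_apply, hX, hk]
  · simp

/-- Adding multiples of row `i` to rows below it. -/
theorem sameOrbit_add_row {L M : Matrix (Fin n) (Fin n) F} (i : Fin n) (c : Fin n → F)
    (hM : ∀ a b, M a b = L a b + if i < a then c a * L i b else 0) :
    SameOrbit (dualOf L) (dualOf M) := by
  let X : strictUpper n F := ⟨fun a b => if a = i ∧ i < b then c b else 0, fun a b hab => by
    refine if_neg ?_
    rintro ⟨rfl, h⟩
    exact absurd h (not_lt.2 hab)⟩
  have hX : ∀ a b, X.1 a b = if a = i ∧ i < b then c b else 0 := fun _ _ => rfl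
  refine ⟨oneAdd X, 1, ?_⟩
  rw [biTranslate_dualOf, coe_oneAdd]
  congr 1
  ext a b
  rw [hM, OneMemClass.coe_one, Units.val_one, Matrix.transpose_one, mul_one,
    Matrix.transpose_add, add_mul, Matrix.transpose_one, one_mul, Matrix.add_apply,
    Matrix.mul_apply]
  congr 1
  rw [Finset.sum_eq_single i]
  · simp [Matrix.transpose_apply, hX]
  · intro k _ hk
    simp [Matrix.transpose_apply, hX, hk]
  · simp

/-! ### Rook representatives of two-sided orbits -/

-- Gaussian elimination from the top row down. The pivot of a row is its rightmost nonzero entry,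
-- because columns may be added only to columns on their left and rows only to rows below.
open Classical in
theorem exists_sameOrbit_isRook (lam : Module.Dual F (strictUpper n F)) :
    ∃ L : Matrix (Fin n) (Fin n) F, IsRook L ∧ SameOrbit lam (dualOf L) := by
  have htrunc : ∀ L : Matrix (Fin n) (Fin n) F,
      dualOf L = dualOf fun i j => if i < j then L i j else 0 := fun L =>
    dualOf_eq_iff.2 fun i j hij => (if_pos hij).symm
  -- Invariant: a nonzero entry in one of the first `m` rows is alone in its row and in its column.
  have key : ∀ m : ℕ, ∃ L : Matrix (Fin n) (Fin n) F, (∀ i j, L i j ≠ 0 → i < j) ∧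
      (∀ i : Fin n, i.1 < m → ∀ j, L i j ≠ 0 →
        (∀ k, L i k ≠ 0 → k = j) ∧ ∀ k, L k j ≠ 0 → k = i) ∧
      SameOrbit lam (dualOf L) := by
    intro m
    induction m with
    | zero =>
      obtain ⟨L, rfl⟩ := exists_dualOf_eq lam
      refine ⟨fun i j => if i < j then L i j else 0, fun i j h => ?_, fun i h => by omega, ?_⟩
      · by_contra hn
        exact h (if_neg hn)
      · rw [← htrunc]
        exact .refl _
    | succ m ih =>
      obtain ⟨L, hlt, hrook, hrel⟩ := ih
      by_cases hrow : ∃ r : Fin n, r.1 = m ∧ ∃ j, L r j ≠ 0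
      swap
      · refine ⟨L, hlt, fun i hi j hj => hrook i ?_ j hj, hrel⟩
        have : i.1 ≠ m := fun h => hrow ⟨i, h, j, hj⟩
        omega
      obtain ⟨r, rfl, j₀, hj₀⟩ := hrow
      obtain ⟨j, hj, hmax⟩ : ∃ j, L r j ≠ 0 ∧ ∀ k, L r k ≠ 0 → k ≤ j := by
        have hne : (Finset.univ.filter fun k => L r k ≠ 0).Nonempty := ⟨j₀, by simp [hj₀]⟩
        have hm := Finset.max'_mem _ hne
        exact ⟨_, (Finset.mem_filter.1 hm).2, fun k hk => Finset.le_max' _ _ (by simp [hk])⟩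
      -- An entry above the pivot would, by the invariant, be the only nonzero entry of its column.
      have hcol : ∀ i : Fin n, i < r → L i j = 0 := by
        intro i hi
        by_contra h
        exact hi.ne' ((hrook i hi j h).2 r hj)
      -- `L₁` clears row `r` left of the pivot and `L₂` clears column `j` below it. `L₃` drops the
      -- entries on or below the diagonal that this may create, which the functional does not see.
      let L₁ : Matrix (Fin n) (Fin n) F := fun a b =>
        L a b + if b < j then L a j * (-L r b / L r j) else 0
      let L₂ : Matrix (Fin n) (Fin n) F := fun a b =>
        L₁ a b + if r < a then (-L₁ a j / L₁ r j) * L₁ r b else 0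
      let L₃ : Matrix (Fin n) (Fin n) F := fun a b => if a < b then L₂ a b else 0
      have hL₁j : ∀ a, L₁ a j = L a j := fun a => by simp [L₁]
      have hL₁r : ∀ b, b ≠ j → L₁ r b = 0 := by
        intro b hb
        rcases lt_or_gt_of_ne hb with h | h
        · simp only [L₁, if_pos h]
          field_simp
          ring
        · simp only [L₁, if_neg h.not_gt, add_zero]
          by_contra hne
          exact absurd (hmax b hne) (not_le.2 h)
      have hL₂r : ∀ b, L₂ r b = L₁ r b := fun b => by simp [L₂]
      have hL₂j : ∀ a, a ≠ r → L₂ a j = 0 := by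
        intro a ha
        rcases lt_or_gt_of_ne ha with h | h
        · simp only [L₂, if_neg h.not_gt, add_zero, hL₁j]
          exact hcol a h
        · simp only [L₂, if_pos h, hL₁j]
          field_simp
          ring
      have hL₂u : ∀ i, i < r → ∀ b, L₂ i b = L i b := by
        intro i hi b
        simp [L₂, L₁, hi.not_gt, hcol i hi]
      have hL₂c : ∀ a b, L r b = 0 → L₂ a b = L a b := by
        intro a b h0
        simp [L₂, L₁, h0]
      have h32 : ∀ {a b}, L₃ a b ≠ 0 → L₂ a b ≠ 0 := by
        intro a b h h2
        exact h (by simp [L₃, h2])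
      refine ⟨L₃, fun a b h => ?_, fun i hi b hb => ?_, ?_⟩
      · by_contra hn
        exact h (if_neg hn)
      · rcases (Nat.lt_succ_iff.1 hi).eq_or_lt with hir | hir
        · obtain rfl : i = r := Fin.ext hir
          have hr : ∀ k, L₃ i k ≠ 0 → k = j := by
            intro k hk
            by_contra hkj
            exact h32 hk (by rw [hL₂r, hL₁r k hkj])
          obtain rfl := hr b hb
          refine ⟨hr, fun k hk => ?_⟩
          by_contra hki
          exact h32 hk (hL₂j k hki)
        · have hir' : i < r := hir
          have hLb : L i b ≠ 0 := by
            rw [← hL₂u i hir']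
            exact h32 hb
          obtain ⟨h1, h2⟩ := hrook i hir b hLb
          have hrb : L r b = 0 := by
            by_contra hne
            exact hir'.ne' (h2 r hne)
          refine ⟨fun k hk => h1 k ?_, fun k hk => h2 k ?_⟩
          · rw [← hL₂u i hir']
            exact h32 hk
          · rw [← hL₂c k b hrb]
            exact h32 hk
      · rw [← htrunc L₂]
        exact hrel.trans ((sameOrbit_add_column j (fun b => -L r b / L r j) fun _ _ => rfl).trans
          (sameOrbit_add_row r (fun a => -L₁ a j / L₁ r j) fun _ _ => rfl))
  obtain ⟨L, hlt, hrook, hrel⟩ := key n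
  exact ⟨L, ⟨fun h => hlt _ _ h, fun {i j k} h h' => ((hrook i i.2 j h).1 k h').symm,
    fun {i j k} h h' => ((hrook i i.2 k h).2 j h').symm⟩, hrel⟩

/-! ### Uniqueness of the rook representative. -/

theorem unitri.apply_self (g : unitri n F) (i : Fin n) : g.1.1 i i = 1 := by
  have := g.2 i i le_rfl
  rwa [Matrix.sub_apply, Matrix.one_apply_eq, sub_eq_zero] at this

theorem unitri.le_of_ne_zero (g : unitri n F) {i j : Fin n} (h : g.1.1 i j ≠ 0) : i ≤ j := by
  by_contra! hlt
  exact h (unitri.blockTriangular g hlt)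

/-- Induction on the row, from the top. Above the diagonal `gᵀL = Muᵀ`, and rook sums have at most
one nonzero term. A nonzero `L i j` forces a nonzero `M i j₁` with `j ≤ j₁`; the case `j = j₁` gives
equality since the diagonals of `g` and `u` are `1`. -/
theorem IsRook.eq_of_ne_zero {L M : Matrix (Fin n) (Fin n) F} (hL : IsRook L) (hM : IsRook M)
    (h : SameOrbit (dualOf L) (dualOf M)) (i : Fin n) :
    ∀ j, L i j ≠ 0 → M i j = L i j := by
  obtain ⟨g, k, h⟩ := h
  let u := k⁻¹
  have h' : dualOf (g.1.1.transpose * L) = dualOf (M * u.1.1.transpose) := by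
    have h1 := congrArg (fun nu => biTranslate nu 1 u) h
    rw [biTranslate_biTranslate, inv_mul_cancel, mul_one, biTranslate_dualOf,
      biTranslate_dualOf] at h1
    simpa using h1.symm
  have hmul : ∀ a b, a < b → ∑ c, g.1.1 c a * L c b = ∑ c, M a c * u.1.1 b c := by
    intro a b hab
    have := dualOf_eq_iff.1 h' a b hab
    simpa [Matrix.mul_apply] using this
  have hcolsum : ∀ a c b, L c b ≠ 0 → ∑ c, g.1.1 c a * L c b = g.1.1 c a * L c b := by
    intro a c b hcb
    refine Finset.sum_eq_single c (fun d _ hd => ?_) (by simp)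
    rw [mul_eq_zero]
    right
    by_contra hne
    exact hd (hL.col hne hcb)
  have hrowsum : ∀ a b c, M a c ≠ 0 → ∑ c, M a c * u.1.1 b c = M a c * u.1.1 b c := by
    intro a b c hac
    refine Finset.sum_eq_single c (fun d _ hd => ?_) (by simp)
    rw [mul_eq_zero]
    left
    by_contra hne
    exact hd (hM.row hne hac)
  induction i using WellFoundedLT.induction with
  | ind i ih =>
    intro j hij
    have h1 := hmul i j (hL.lt hij)
    rw [hcolsum i i j hij, unitri.apply_self g, one_mul] at h1
    obtain ⟨j₁, -, hj₁⟩ := Finset.exists_ne_zero_of_sum_ne_zero (h1 ▸ hij)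
    have hM₁ := left_ne_zero_of_mul hj₁
    have hle := unitri.le_of_ne_zero u (right_ne_zero_of_mul hj₁)
    rcases hle.eq_or_lt with rfl | hlt
    · rw [hrowsum i _ _ hM₁, unitri.apply_self u, mul_one] at h1
      exact h1.symm
    -- If `j < j₁`, comparing at `(i, j₁)` gives a nonzero `L i₁ j₁` with `i₁ ≤ i`. Then either row
    -- `i` of `L` has two nonzero entries or, by induction on `i₁ < i`, column `j₁` of `M` does.
    · exfalso
      have h2 := hmul i j₁ (hM.lt hM₁)
      rw [hrowsum i _ _ hM₁, unitri.apply_self u, mul_one] at h2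
      obtain ⟨i₁, -, hi₁⟩ := Finset.exists_ne_zero_of_sum_ne_zero (h2.symm ▸ hM₁)
      have hL₁ := right_ne_zero_of_mul hi₁
      rcases (unitri.le_of_ne_zero g (left_ne_zero_of_mul hi₁)).eq_or_lt with rfl | hlt'
      · exact hlt.ne (hL.row hij hL₁)
      · have hM₂ := ih i₁ hlt' j₁ hL₁
        exact hlt'.ne (hM.col (hM₂ ▸ hL₁) hM₁)

theorem IsRook.eq_of_sameOrbit {L M : Matrix (Fin n) (Fin n) F} (hL : IsRook L) (hM : IsRook M)
    (h : SameOrbit (dualOf L) (dualOf M)) : L = M := by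
  ext i j
  by_cases h1 : L i j = 0
  · by_cases h2 : M i j = 0
    · rw [h1, h2]
    · exact hM.eq_of_ne_zero hL h.symm i j h2
  · exact (hL.eq_of_ne_zero hM h i j h1).symm

theorem LabeledPartition.functional_eq_dualOf (Λ : LabeledPartition n F) :
    Λ.functional = dualOf Λ.toMatrix := by
  classical
  ext X
  let _ : Fintype {a : Fin n × Fin n // Λ.part.IsArc a.1 a.2} := Fintype.ofFinite _
  change ∑ a : {a : Fin n × Fin n // Λ.part.IsArc a.1 a.2}, (Λ.label a : F) * X.1 a.1.1 a.1.2 = _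
  rw [dualOf_apply, ← Fintype.sum_prod_type' (f := fun i j => Λ.toMatrix i j * X.1 i j),
    ← Finset.sum_subset (Finset.subset_univ
      (Finset.univ.filter fun a : Fin n × Fin n => Λ.part.IsArc a.1 a.2))]
  · rw [Finset.sum_subtype (p := fun a : Fin n × Fin n => Λ.part.IsArc a.1 a.2) _ (by simp)]
    refine Finset.sum_congr rfl fun a _ => ?_
    rw [Λ.toMatrix_of_isArc a.2]
  · intro a _ ha
    rw [not_imp_comm.1 Λ.toMatrix_ne_zero_iff.1 (by simpa using ha), zero_mul]

end DualOf

/-! ### Superdiagonal functionals -/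

section Superdiag

variable {n : ℕ} {F : Type*} [Field F]

/-- The matrix with superdiagonal entries `d` and zeros elsewhere. -/
def superdiag (d : Fin n → F) : Matrix (Fin (n + 1)) (Fin (n + 1)) F :=
  fun i j => ∑ k, if i = k.castSucc ∧ j = k.succ then d k else 0

theorem dualOf_superdiag (d : Fin n → F) (X : strictUpper (n + 1) F) :
    dualOf (superdiag d) X = ∑ k : Fin n, d k * X.1 k.castSucc k.succ := by
  simp only [dualOf_apply, superdiag, Finset.sum_mul]
  simp_rw [Finset.sum_comm (s := Finset.univ (α := Fin (n + 1))) (t := Finset.univ (α := Fin n))]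
  refine Finset.sum_congr rfl fun k _ => ?_
  rw [Finset.sum_eq_single k.castSucc, Finset.sum_eq_single k.succ] <;> simp +contextual

/-- Every other term of the product needs an entry of `X` on or below the diagonal. This is what
makes superdiagonal functionals invariant. -/
theorem biMul_apply_superdiag (g h : unitri (n + 1) F) (X : strictUpper (n + 1) F) (k : Fin n) :
    (biMul g h X).1 k.castSucc k.succ = X.1 k.castSucc k.succ := by
  rw [coe_biMul, Matrix.mul_apply, Finset.sum_eq_single k.succ]
  · rw [unitri.apply_self h, mul_one, Matrix.mul_apply, Finset.sum_eq_single k.castSucc]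
    · rw [unitri.apply_self g, one_mul]
    · intro b _ hb
      by_contra hne
      have h1 := (unitri.le_of_ne_zero g (left_ne_zero_of_mul hne)).lt_of_ne hb.symm
      refine right_ne_zero_of_mul hne (X.2 _ _ ?_)
      exact Fin.castSucc_lt_iff_succ_le.1 h1
    · simp
  · intro b _ hb
    by_contra hne
    have h1 := (unitri.le_of_ne_zero h (right_ne_zero_of_mul hne)).lt_of_ne hb
    refine left_ne_zero_of_mul hne (strictUpper_mul (unitri.blockTriangular g) X.2 _ _ ?_)
    exact Fin.le_castSucc_iff.2 h1
  · simp

theorem biTranslate_superdiag (d : Fin n → F) (g h : unitri (n + 1) F) :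
    biTranslate (dualOf (superdiag d)) g h = dualOf (superdiag d) := by
  ext X
  rw [biTranslate_apply, dualOf_superdiag, dualOf_superdiag]
  simp only [biMul_apply_superdiag]

theorem dualOf_superdiag_unitriSubOne (c : F) (g : unitri (n + 1) F) :
    dualOf (superdiag fun _ => c) (unitriSubOne g) = c * superdiagSum g := by
  rw [dualOf_superdiag, superdiagSum, Finset.mul_sum]
  refine Finset.sum_congr rfl fun k _ => ?_
  rw [coe_unitriSubOne, Matrix.sub_apply, Matrix.one_apply_ne (Fin.castSucc_lt_succ).ne, sub_zero]

theorem superdiag_apply (d : Fin n → F) (k : Fin n) :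
    superdiag d k.castSucc k.succ = d k := by
  simp [superdiag]

theorem superdiag_add (d e : Fin n → F) : superdiag (d + e) = superdiag d + superdiag e := by
  ext i j
  simp only [superdiag, Matrix.add_apply, ← Finset.sum_add_distrib]
  refine Finset.sum_congr rfl fun k _ => ?_
  split_ifs <;> simp

/-! ### Absorbing superdiagonal functionals into an orbit. -/

theorem SameOrbit.add_superdiag {lam mu : Module.Dual F (strictUpper (n + 1) F)}
    (h : SameOrbit lam mu) (d : Fin n → F) :
    SameOrbit (lam + dualOf (superdiag d)) (mu + dualOf (superdiag d)) := by
  obtain ⟨g, k, rfl⟩ := h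
  refine ⟨g, k, ?_⟩
  rw [show biTranslate (lam + dualOf (superdiag d)) g k =
    biTranslate lam g k + biTranslate (dualOf (superdiag d)) g k from rfl, biTranslate_superdiag]

/-- The covering entry is alone in its column (or row), so adding a suitable multiple of that column
to column `k + 1` (or of that row to row `k`) changes only position `(k, k + 1)`. -/
theorem IsRook.sameOrbit_add_single {M : Matrix (Fin (n + 1)) (Fin (n + 1)) F} (hM : IsRook M)
    {k : Fin n} (hk : IsCoveredAt M k) (c : F) :
    SameOrbit (dualOf M) (dualOf M + dualOf (superdiag (Pi.single k c))) := by
  classical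
  have hs : ∀ a b, superdiag (Pi.single k c) a b =
      if a = k.castSucc ∧ b = k.succ then c else 0 := by
    intro a b
    rw [superdiag, Finset.sum_eq_single k]
    · simp
    · intro l _ hl
      simp [hl]
    · simp
  rw [← dualOf_add]
  rcases hk with ⟨j, hj, hne⟩ | ⟨i, hi, hne⟩
  · refine sameOrbit_add_column j (Pi.single k.succ (c / M k.castSucc j)) fun a b => ?_
    rw [Matrix.add_apply, hs]
    congr 1
    by_cases hb : b = k.succ
    · subst hb
      by_cases ha : a = k.castSucc
      · subst ha
        simp [hj, mul_div_cancel₀ _ hne]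
      · have : M a j = 0 := by
          by_contra h
          exact ha (hM.col h hne)
        simp [ha, this]
    · simp [hb]
  · refine sameOrbit_add_row i (Pi.single k.castSucc (c / M i k.succ)) fun a b => ?_
    rw [Matrix.add_apply, hs]
    congr 1
    by_cases ha : a = k.castSucc
    · subst ha
      by_cases hb : b = k.succ
      · subst hb
        simp [hi, div_mul_cancel₀ _ hne]
      · have : M i b = 0 := by
          by_contra h
          exact hb (hM.row h hne)
        simp [hb, this]
    · simp [ha]

theorem IsRook.sameOrbit_add_superdiag {M : Matrix (Fin (n + 1)) (Fin (n + 1)) F} (hM : IsRook M)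
    (d : Fin n → F) (hd : ∀ k, d k ≠ 0 → IsCoveredAt M k) :
    SameOrbit (dualOf M) (dualOf M + dualOf (superdiag d)) := by
  classical
  have key : ∀ s : Finset (Fin n), SameOrbit (dualOf M)
      (dualOf M + dualOf (superdiag (∑ k ∈ s, Pi.single k (d k)))) := by
    intro s
    induction s using Finset.induction_on with
    | empty =>
      have : superdiag (0 : Fin n → F) = 0 := by
        ext i j
        simp [superdiag]
      rw [Finset.sum_empty, this, ← dualOf_add, add_zero]
      exact .refl _
    | insert k s hk ih =>
      rw [Finset.sum_insert hk, superdiag_add, dualOf_add, ← add_assoc]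
      by_cases h0 : d k = 0
      · have : superdiag (0 : Fin n → F) = 0 := by
          ext i j
          simp [superdiag]
        rw [h0, Pi.single_zero, this, ← dualOf_add, add_zero]
        exact ih
      · exact ih.trans ((hM.sameOrbit_add_single (hd k h0) (d k)).add_superdiag _)
  have h := key Finset.univ
  rwa [Finset.univ_sum_single] at h

/-- If adding `1` to all superdiagonal entries stays in the orbit of the rook matrix `M`, then each
superdiagonal position is covered. -/
theorem IsRook.isCoveredAt {M : Matrix (Fin (n + 1)) (Fin (n + 1)) F} (hM : IsRook M)
    (h : SameOrbit (dualOf M) (dualOf M + dualOf (superdiag fun _ => 1))) :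
    ∀ k, IsCoveredAt M k := by
  classical
  -- Split the all-ones vector into its covered part `d`, which the orbit absorbs, and its uncovered
  -- part `e`. Then `M + superdiag e` is a rook matrix in the orbit of `M`, so uniqueness forces `e
  -- = 0`.
  let d : Fin n → F := fun k => if IsCoveredAt M k then 1 else 0
  let e : Fin n → F := fun k => if IsCoveredAt M k then 0 else 1
  have hde : superdiag (fun _ => (1 : F)) = superdiag d + superdiag e := by
    rw [← superdiag_add]
    congr 1
    ext k
    simp only [d, e, Pi.add_apply]
    split_ifs <;> simp
  have h1 := hM.sameOrbit_add_superdiag d fun k hk => by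
    by_contra hn
    exact hk (if_neg hn)
  have h2 : SameOrbit (dualOf M) (dualOf (M + superdiag e)) := by
    rw [dualOf_add]
    refine h.trans ?_
    rw [hde, dualOf_add, ← add_assoc]
    exact (h1.add_superdiag e).symm
  have hsd : ∀ i j, superdiag e i j ≠ 0 →
      ∃ k : Fin n, ¬ IsCoveredAt M k ∧ i = k.castSucc ∧ j = k.succ := by
    intro i j hij
    obtain ⟨k, -, hk⟩ := Finset.exists_ne_zero_of_sum_ne_zero hij
    rw [ite_ne_right_iff] at hk
    exact ⟨k, fun hc => hk.2 (if_pos hc), hk.1⟩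
  -- At an uncovered `k`, row `k` and column `k + 1` of `M` vanish outside `(k, k + 1)`, so adding
  -- there keeps the rook property even if that entry of `M` is nonzero.
  have hrow : ∀ k : Fin n, ¬ IsCoveredAt M k → ∀ j, M k.castSucc j ≠ 0 → j = k.succ := by
    intro k hk j hj
    by_contra hne
    refine hk (Or.inl ⟨j, lt_of_le_of_ne ?_ (Ne.symm hne), hj⟩)
    exact Fin.castSucc_lt_iff_succ_le.1 (hM.lt hj)
  have hcol : ∀ k : Fin n, ¬ IsCoveredAt M k → ∀ i, M i k.succ ≠ 0 → i = k.castSucc := by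
    intro k hk i hi
    by_contra hne
    refine hk (Or.inr ⟨i, lt_of_le_of_ne ?_ hne, hi⟩)
    exact Fin.le_castSucc_iff.2 (hM.lt hi)
  have hor : ∀ i j, (M + superdiag e) i j ≠ 0 → M i j ≠ 0 ∨ superdiag e i j ≠ 0 := by
    intro i j hij
    by_contra! hn
    exact hij (by rw [Matrix.add_apply, hn.1, hn.2, add_zero])
  have hrook : IsRook (M + superdiag e) :=
    { lt := fun {i j} hij => by
        rcases hor i j hij with h | h
        · exact hM.lt h
        · obtain ⟨k, -, rfl, rfl⟩ := hsd i j h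
          exact Fin.castSucc_lt_succ
      row := fun {i j l} hij hil => by
        rcases hor i j hij with h | h <;> rcases hor i l hil with h' | h'
        · exact hM.row h h'
        · obtain ⟨k, hk, rfl, rfl⟩ := hsd i l h'
          exact hrow k hk j h
        · obtain ⟨k, hk, rfl, rfl⟩ := hsd i j h
          exact (hrow k hk l h').symm
        · obtain ⟨k, hk, rfl, rfl⟩ := hsd i j h
          obtain ⟨k', -, hkk, rfl⟩ := hsd _ l h'
          rw [Fin.castSucc_injective _ hkk]
      col := fun {i j l} hil hjl => by
        rcases hor i l hil with h | h <;> rcases hor j l hjl with h' | h'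
        · exact hM.col h h'
        · obtain ⟨k, hk, rfl, rfl⟩ := hsd j l h'
          exact hcol k hk i h
        · obtain ⟨k, hk, rfl, rfl⟩ := hsd i l h
          exact (hcol k hk j h').symm
        · obtain ⟨k, hk, rfl, rfl⟩ := hsd i l h
          obtain ⟨k', -, rfl, hkk⟩ := hsd j _ h'
          rw [Fin.succ_injective _ hkk] }
  have heq := hM.eq_of_sameOrbit hrook h2
  intro k
  by_contra hk
  have h3 := congrFun (congrFun heq k.castSucc) k.succ
  rw [Matrix.add_apply, superdiag_apply, left_eq_add] at h3
  exact one_ne_zero ((if_neg hk).symm.trans h3)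

end Superdiag

/-! ### The main theorem -/

section Main

variable {n : ℕ} {F : Type*} [Field F] [Fintype F] {θ : AddChar F ℂ}

theorem isCInvariant_superchar_iff (hθ : θ ≠ 1) {M : Matrix (Fin (n + 1)) (Fin (n + 1)) F}
    (hM : IsRook M) :
    IsCInvariant (superchar θ (dualOf M)) ↔ ∀ k, IsCoveredAt M k := by
  have hmul : ∀ (c : F) (g : unitri (n + 1) F),
      superchar θ (dualOf M + dualOf (superdiag fun _ => c)) g =
        θ (c * superdiagSum g) * superchar θ (dualOf M) g := by
    intro c g
    rw [superchar_add_invariant hθ _ _ (biTranslate_superdiag _), dualOf_superdiag_unitriSubOne]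
  constructor
  · intro h
    -- The single character `θ ∘ σ`, that is `c = 1`, already forces covering.
    refine hM.isCoveredAt ((superchar_eq_iff hθ).1 ?_)
    ext g
    rw [hmul, one_mul]
    exact (congrFun (h _ ⟨θ, rfl⟩) g).symm
  · rintro h _ ⟨ϑ, rfl⟩
    ext g
    change ϑ (superdiagSum g) * superchar θ (dualOf M) g = superchar θ (dualOf M) g
    -- There is no need to write `ϑ` in terms of `θ`: where `σ(g) ≠ 0`, invariance under some `θ(c
    -- σ)` with `θ(c σ(g)) ≠ 1` makes the supercharacter vanish, and where `σ(g) = 0` the factor is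
    -- `1`.
    by_cases hg : superdiagSum g = 0
    · rw [hg, AddChar.map_zero_eq_one, one_mul]
    · obtain ⟨c, hc⟩ := addChar_mul_ne_one hθ hg
      have h1 := (superchar_eq_iff hθ).2 (hM.sameOrbit_add_superdiag (fun _ => c) fun k _ => h k)
      have h2 := congrFun h1 g
      rw [hmul] at h2
      have h3 : superchar θ (dualOf M) g = 0 := by
        by_contra hne
        exact hc (mul_right_cancel₀ hne (by rw [← h2, one_mul]))
      rw [h3, mul_zero]

end Main

theorem mainTheorem7 {F : Type*} [Field F] [Fintype F] (θ : AddChar F ℂ) (hθ : θ ≠ 1) (n : ℕ) :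
    Set.BijOn (fun Λ : LabeledPartition n F => superchar θ Λ.shift.functional)
      {Λ | Λ.part.IsFeasible}
      {χ | χ ∈ supercharacters (n + 1) θ ∧ IsCInvariant χ} ∧
    (({χ : unitri (n + 1) F → ℂ |
        χ ∈ supercharacters (n + 1) θ ∧ IsCInvariant χ}.ncard : ℕ) : ℤ) =
      (feasiblePoly n).eval ((Fintype.card F : ℤ) - 1) := by
  have hbij : Set.BijOn (fun Λ : LabeledPartition n F => superchar θ Λ.shift.functional)
      {Λ | Λ.part.IsFeasible} {χ | χ ∈ supercharacters (n + 1) θ ∧ IsCInvariant χ} := by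
    simp_rw [LabeledPartition.functional_eq_dualOf]
    refine ⟨fun Λ hΛ => ⟨(mem_supercharacters_iff hθ).2 ⟨_, rfl⟩, ?_⟩, fun Λ _ Λ' _ h => ?_, ?_⟩
    · exact (isCInvariant_superchar_iff hθ Λ.shift.isRook_toMatrix).2
        (LabeledPartition.isCoveredAt_shift hΛ)
    · exact LabeledPartition.toMatrix_shift_injective
        (Λ.shift.isRook_toMatrix.eq_of_sameOrbit Λ'.shift.isRook_toMatrix
          ((superchar_eq_iff hθ).1 h))
    · rintro χ ⟨hχ, hinv⟩
      obtain ⟨lam, rfl⟩ := (mem_supercharacters_iff hθ).1 hχ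
      obtain ⟨M, hM, hlam⟩ := exists_sameOrbit_isRook lam
      rw [(superchar_eq_iff hθ).2 hlam] at hinv ⊢
      obtain ⟨Λ, hΛ, rfl⟩ := hM.exists_shift ((isCInvariant_superchar_iff hθ hM).1 hinv)
      exact ⟨Λ, hΛ, rfl⟩
  refine ⟨hbij, ?_⟩
  rw [← hbij.image_eq, hbij.injOn.ncard_image]
  exact ncard_feasible n F
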